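/- Let $r,N\ge 0$, let $U=\mathbb R^r$ with Lebesgue measure, and let $Z=(z_1,\dots,z_N)$ be a list of vectors in $U$ from which a basis $B=(b_1,\dots,b_r)$ of $U$ has been selected as a sublist (ordered as in $Z$). For a finite list $X=(x_1,\dots,x_n)$ in $U$ write $\mathrm{cone}(X)=\{\sum_i\lambda_ix_i:\lambda_i\ge0\}$; if some linear functional is positive on all $x_i$, the multivariate spline $T_X$ is the distribution on $U$ given by $$T_X(\varphi)=\int_0^\infty\!\!\cdots\int_0^\infty \varphi\Big(\sum_{i=1}^n\lambda_ix_i\Big)\,d\lambda_1\cdots d\lambda_n .$$ The convolution of two distributions $S,T$ on $U$ is defined if $\mathrm{supp}(S)\cap(K-\mathrm{supp}(T))$ is compact for every compact $K\subseteq U$; it is $(S*T)(\varphi)=S_\xi\big(T_\eta(\alpha(\xi)\varphi(\xi+\eta))\big)$, where $\alpha$ is any test function equal to $1$ on a neighbourhood of $\mathrm{supp}(S)\cap(\mathrm{supp}(\varphi)-\mathrm{supp}(T))$; the empty convolution is $\delta_0$. For $0\le i\le r$ let $S_i=\mathrm{span}(b_1,\dots,b_i)$, oriented so that $(b_1,\dots,b_i)$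 is a positive basis. Let $P_i$ (resp. $N_i$) be the sublist of those $u$ in $Z\cap(S_i\setminus S_{i-1})$ for which the basis $(b_1,\dots,b_{i-1},u)$ of $S_i$ is positive (resp. negative). Put $$T_i^{B+}=(-1)^{|N_i|}\,T_{P_i}*T_{-N_i},\quad T_i^{B-}=(-1)^{|P_i|}\,T_{-P_i}*T_{N_i},\quad R_i^B=T_i^{B+}-T_i^{B-},\quad R^B_Z=R_1^B*\cdots*R_r^B .$$ For $c>0$ let $\tau_c=b_1+\tfrac1c b_2+\dots+\tfrac1{c^{r-1}}b_r$, and let $Z^{B+}=\bigcup_{i=1}^r(P_i,-N_i)$. Then all splines and convolutions in the definitions of $R^B_Z$ and of $T_1^{B+}*\cdots*T_r^{B+}$ are well-defined, and there is a nonzero polynomial $p\in\mathbb R[s_1,\dots,s_r]$ such that 1. $R^B_Z=p$ as distributions, i.e. $R^B_Z(\varphi)=\int_U p(x)\varphi(x)\,dx$ for every test function $\varphi$; 2. $p$ is the local piece of $T_1^{B+}*\cdots*T_r^{B+}$ near $\tau_c$ for large $c$: there are an open convex cone $C\subseteq\mathrm{cone}(Z^{B+})$ and $c_0>0$ such that $\tau_c\in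 C$ for all $c\ge c_0$, and $(T_1^{B+}*\cdots*T_r^{B+})(\varphi)=\int_U p(x)\varphi(x)\,dx$ for every test function $\varphi$ with support in $C$; 3. if $Z$ contains no zero vector, then $p$ is homogeneous of degree $N-r=|Z|-r$. -/

import Mathlib

open MeasureTheory TopologicalSpace
open scoped Distributions Pointwise Topology

namespace ZonotopalSpline

/-- The vector space `U = ℝ^r`. -/
abbrev Vec (r : ℕ) : Type := Fin r → ℝ

/-- Test functions on `ℝ^r`: compactly supported smooth functions `ℝ^r → ℝ`. -/
abbrev Test (r : ℕ) : Type := 𝓓((⊤ : Opens (Vec r)), ℝ)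

/-- Distributions on `ℝ^r`: continuous linear functionals on the test functions. -/
abbrev Distr (r : ℕ) : Type := 𝓓'((⊤ : Opens (Vec r)), ℝ)

/-- The distribution `φ ↦ ∫ φ(x) f(x) dμ(x)`, for `f` locally integrable with respect to `μ`
(and `0` if `f` is not locally integrable). -/
noncomputable def distrOfDensity {r : ℕ} (μ : Measure (Vec r)) (f : Vec r → ℝ) : Distr r :=
  (TestFunction.integralAgainstBilinCLM (ContinuousLinearMap.mul ℝ ℝ) μ f :
    Test r →L[ℝ] ℝ)

/-- The distribution `φ ↦ ∫ p(x) φ(x) dx` with which a polynomial `p` is identified. -/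
noncomputable def polyDistr {r : ℕ} (p : MvPolynomial (Fin r) ℝ) : Distr r :=
  distrOfDensity volume (fun x => MvPolynomial.eval x p)

theorem polyDistr_apply {r : ℕ} (p : MvPolynomial (Fin r) ℝ) (φ : Test r) :
    polyDistr p φ = ∫ x, φ x * MvPolynomial.eval x p := by
  have h : LocallyIntegrableOn (fun x : Vec r => MvPolynomial.eval x p)
      ((⊤ : Opens (Vec r)) : Set (Vec r)) volume :=
    ((MvPolynomial.continuous_eval p).locallyIntegrable).locallyIntegrableOn _
  exact TestFunction.integralAgainstBilinCLM_eq_integral (B := ContinuousLinearMap.mul ℝ ℝ) h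

/-! ### Cones and multivariate splines -/

/-- `cone(X)`, the set of nonnegative combinations of the list `X`. -/
def listCone {r : ℕ} {ι : Type*} [Fintype ι] (X : ι → Vec r) : Set (Vec r) :=
  {u | ∃ l : ι → ℝ, (∀ i, 0 ≤ l i) ∧ u = ∑ i, l i • X i}

/-- Some linear functional is positive on all members of the list `X`: this is the condition
under which the multivariate spline `T_X` is defined. -/
def Pointed {r : ℕ} {ι : Type*} (X : ι → Vec r) : Prop :=
  ∃ f : Vec r →ₗ[ℝ] ℝ, ∀ i, 0 < f (X i)

/-- The image of Lebesgue measure on the orthant `[0,∞)^ι` under `l ↦ ∑ i, l i • X i`. -/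
noncomputable def splineMeasure {r : ℕ} {ι : Type*} [Fintype ι] (X : ι → Vec r) :
    Measure (Vec r) :=
  ((volume : Measure (ι → ℝ)).restrict (Set.Ici 0)).map (fun l => ∑ i, l i • X i)

/-- The multivariate spline `T_X`, the distribution
`φ ↦ ∫_{[0,∞)^ι} φ (∑ i, l i • X i) dl` (see `spline_apply`). -/
noncomputable def spline {r : ℕ} {ι : Type*} [Fintype ι] (X : ι → Vec r) : Distr r :=
  distrOfDensity (splineMeasure X) (fun _ => 1)

theorem measurable_comb {r : ℕ} {ι : Type*} [Fintype ι] (X : ι → Vec r) :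
    Measurable (fun l : ι → ℝ => ∑ i, l i • X i) := by
  have : Continuous (fun l : ι → ℝ => ∑ i, l i • X i) := by fun_prop
  exact this.measurable

theorem spline_locallyIntegrable {r : ℕ} {ι : Type*} [Fintype ι] {X : ι → Vec r}
    (hX : Pointed X) :
    LocallyIntegrableOn (fun _ : Vec r => (1 : ℝ)) ((⊤ : Opens (Vec r)) : Set (Vec r))
      (splineMeasure X) := by
  obtain ⟨f, hf⟩ := hX
  have hfc : Continuous f := f.continuous_of_finiteDimensional
  apply LocallyIntegrable.locallyIntegrableOn
  rw [locallyIntegrable_iff]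
  intro K hK
  rw [integrableOn_const_iff]
  right
  obtain ⟨M, hM⟩ := (hK.image hfc).bddAbove
  rw [splineMeasure, Measure.map_apply (measurable_comb X) hK.measurableSet,
    Measure.restrict_apply (measurable_comb X hK.measurableSet)]
  refine lt_of_le_of_lt (measure_mono ?_)
    ((isCompact_Icc (a := (0 : ι → ℝ)) (b := fun i => M / f (X i))).measure_lt_top)
  rintro l ⟨hlK, hl⟩
  refine ⟨hl, fun i => ?_⟩
  have h1 : f (∑ i, l i • X i) ≤ M := hM ⟨_, hlK, rfl⟩
  rw [map_sum] at h1
  have h2 : l i * f (X i) ≤ ∑ j, f (l j • X j) := by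
    have := Finset.single_le_sum (f := fun j => f (l j • X j))
      (fun j _ => by
        simp only [map_smul, smul_eq_mul]
        exact mul_nonneg (hl j) (hf j).le) (Finset.mem_univ i)
    simpa using this
  rw [le_div_iff₀ (hf i)]
  exact h2.trans h1

/-- The formula that characterises the multivariate spline. -/
theorem spline_apply {r : ℕ} {ι : Type*} [Fintype ι] {X : ι → Vec r}
    (hX : Pointed X) (φ : Test r) :
    spline X φ = ∫ l in Set.Ici (0 : ι → ℝ), φ (∑ i, l i • X i) := by
  have h := TestFunction.integralAgainstBilinCLM_eq_integral
    (B := ContinuousLinearMap.mul ℝ ℝ) (spline_locallyIntegrable hX) (f := φ)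
  refine h.trans ?_
  rw [splineMeasure, integral_map (measurable_comb X).aemeasurable]
  · simp
  · refine Continuous.aestronglyMeasurable ?_
    simpa using φ.continuous

/-! ### Convolution of distributions -/

/-- The test function `η ↦ φ (ξ + η)`. -/
noncomputable def translate {r : ℕ} (ξ : Vec r) (φ : Test r) : Test r where
  toFun η := φ (ξ + η)
  contDiff' := φ.contDiff.comp (contDiff_const.add contDiff_id)
  hasCompactSupport' := φ.hasCompactSupport.comp_homeomorph (Homeomorph.addLeft ξ)
  tsupport_subset' := fun _ _ => trivial

/-- `α` is equal to one on a neighbourhood of `supp S ∩ (supp φ - supp T)`. -/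
def IsCutoff {r : ℕ} (S T : Distr r) (φ α : Test r) : Prop :=
  ∀ᶠ ξ in 𝓝ˢ (Distribution.dsupport S ∩ (tsupport φ - Distribution.dsupport T)), α ξ = 1

/-- `ψ` is the test function `ξ ↦ T_η (α(ξ) φ(ξ + η))`. -/
def IsPartialValue {r : ℕ} (T : Distr r) (φ α ψ : Test r) : Prop :=
  ∀ ξ, ψ ξ = T (α ξ • translate ξ φ)

/-- `R` is the convolution `S * T`: the set `supp S ∩ (K - supp T)` is compact for all compact
`K`, and `(S * T)(φ) = S_ξ (T_η (α(ξ) φ(ξ + η)))`, where `α` is a cutoff function; cutoff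
functions for which the right-hand side is defined exist, and the value does not depend on the
choice of `α`. -/
structure IsConvolution {r : ℕ} (S T R : Distr r) : Prop where
  isCompact_inter : ∀ K : Set (Vec r), IsCompact K →
    IsCompact (Distribution.dsupport S ∩ (K - Distribution.dsupport T))
  exists_cutoff : ∀ φ : Test r, ∃ α ψ : Test r, IsCutoff S T φ α ∧ IsPartialValue T φ α ψ
  apply_eq : ∀ φ α ψ : Test r, IsCutoff S T φ α → IsPartialValue T φ α ψ → R φ = S ψ

theorem IsConvolution.unique {r : ℕ} {S T R R' : Distr r} (h : IsConvolution S T R)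
    (h' : IsConvolution S T R') : R = R' := by
  refine DFunLike.ext _ _ fun φ => ?_
  obtain ⟨α, ψ, h1, h2⟩ := h.exists_cutoff φ
  rw [h.apply_eq φ α ψ h1 h2, h'.apply_eq φ α ψ h1 h2]

/-- The convolution of `S` and `T` is well-defined. -/
def Convolvable {r : ℕ} (S T : Distr r) : Prop := ∃ R, IsConvolution S T R

open Classical in
/-- The convolution `S * T` (and `0` if it is not defined). -/
noncomputable def conv {r : ℕ} (S T : Distr r) : Distr r :=
  if h : Convolvable S T then h.choose else 0

theorem IsConvolution.conv_eq {r : ℕ} {S T R : Distr r} (h : IsConvolution S T R) :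
    conv S T = R := by
  have h' : Convolvable S T := ⟨R, h⟩
  rw [conv, dif_pos h']
  exact h'.choose_spec.unique h

/-- The iterated convolution `T_1 * ⋯ * T_n` (bracketed to the left); the empty convolution is
the unit `δ_0`. -/
noncomputable def iterConv {r : ℕ} : (n : ℕ) → (Fin n → Distr r) → Distr r
  | 0, _ => Distribution.delta 0
  | n + 1, T => conv (iterConv n (fun i => T i.castSucc)) (T (Fin.last n))

/-- All the convolutions that occur in `T_1 * ⋯ * T_n` are well-defined. -/
def IterConvolvable {r : ℕ} : (n : ℕ) → (Fin n → Distr r) → Prop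
  | 0, _ => True
  | n + 1, T => IterConvolvable n (fun i => T i.castSucc) ∧
      Convolvable (iterConv n (fun i => T i.castSucc)) (T (Fin.last n))

/-! ### The construction

`b = (b_1, …, b_r)` is an ordered basis; Lean's `b i`, with `i : Fin r`, is `b_{i+1}`. -/

/-- The subspace `S_i = span {b_1, …, b_i}`. -/
def flag {r : ℕ} (b : Fin r → Vec r) (i : ℕ) : Submodule ℝ (Vec r) :=
  Submodule.span ℝ (b '' {ν | (ν : ℕ) < i})

/-- `(d_1, …, d_{i+1})` is a positive basis of `S_{i+1}`: the linear map `S_{i+1} → S_{i+1}` that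
sends `b_ν` to `d_ν` for `1 ≤ ν ≤ i + 1` has positive determinant. -/
def IsPositiveBasis {r : ℕ} (b : Fin r → Vec r) (i : Fin r) (d : Fin r → Vec r) : Prop :=
  ∃ f : flag b (i + 1) →ₗ[ℝ] flag b (i + 1),
    (∀ ν ≤ i, ∀ x : flag b (i + 1), (x : Vec r) = b ν → (f x : Vec r) = d ν) ∧
    0 < LinearMap.det f

/-- `u ∈ S_{i+1} \ S_i` is positive: `(b_1, …, b_i, u)` is a positive basis of `S_{i+1}`. -/
def IsPositive {r : ℕ} (b : Fin r → Vec r) (i : Fin r) (u : Vec r) : Prop :=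
  IsPositiveBasis b i (Function.update b i u)

open Classical in
/-- (The positions in the list `Z` of) the positive vectors in `Z ∩ (S_{i+1} \ S_i)`. -/
noncomputable def posPart {r N : ℕ} (Z : Fin N → Vec r) (b : Fin r → Vec r) (i : Fin r) :
    Finset (Fin N) :=
  {k | Z k ∈ flag b (i + 1) ∧ Z k ∉ flag b i ∧ IsPositive b i (Z k)}

open Classical in
/-- (The positions in the list `Z` of) the negative vectors in `Z ∩ (S_{i+1} \ S_i)`. -/
noncomputable def negPart {r N : ℕ} (Z : Fin N → Vec r) (b : Fin r → Vec r) (i : Fin r) :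
    Finset (Fin N) :=
  {k | Z k ∈ flag b (i + 1) ∧ Z k ∉ flag b i ∧ ¬ IsPositive b i (Z k)}

/-- The sublist of `Z` on the positions `A`. -/
def sub {r N : ℕ} (Z : Fin N → Vec r) (A : Finset (Fin N)) : A → Vec r := fun k => Z k

/-- `T_i^{B+} = (-1)^{|N_i|} T_{P_i} * T_{-N_i}`. -/
noncomputable def Tplus {r N : ℕ} (Z : Fin N → Vec r) (b : Fin r → Vec r) (i : Fin r) :
    Distr r :=
  ((-1 : ℝ) ^ (negPart Z b i).card) •
    conv (spline (sub Z (posPart Z b i))) (spline (-sub Z (negPart Z b i)))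

/-- `T_i^{B-} = (-1)^{|P_i|} T_{-P_i} * T_{N_i}`. -/
noncomputable def Tminus {r N : ℕ} (Z : Fin N → Vec r) (b : Fin r → Vec r) (i : Fin r) :
    Distr r :=
  ((-1 : ℝ) ^ (posPart Z b i).card) •
    conv (spline (-sub Z (posPart Z b i))) (spline (sub Z (negPart Z b i)))

/-- `R_i^B = T_i^{B+} - T_i^{B-}`. -/
noncomputable def Rfactor {r N : ℕ} (Z : Fin N → Vec r) (b : Fin r → Vec r) (i : Fin r) :
    Distr r :=
  Tplus Z b i - Tminus Z b i

/-- The distribution `R^B_Z = R_1^B * ⋯ * R_r^B`. -/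
noncomputable def RB {r N : ℕ} (Z : Fin N → Vec r) (b : Fin r → Vec r) : Distr r :=
  iterConv r (Rfactor Z b)

/-- The multivariate spline `T_1^{B+} * ⋯ * T_r^{B+}`. -/
noncomputable def TB {r N : ℕ} (Z : Fin N → Vec r) (b : Fin r → Vec r) : Distr r :=
  iterConv r (Tplus Z b)

/-- All splines and all convolutions in the construction of `R^B_Z` and of
`T_1^{B+} * ⋯ * T_r^{B+}` are well-defined. -/
structure WellDefined {r N : ℕ} (Z : Fin N → Vec r) (b : Fin r → Vec r) : Prop where
  pointed_pos : ∀ i, Pointed (sub Z (posPart Z b i))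
  pointed_neg_pos : ∀ i, Pointed (-sub Z (posPart Z b i))
  pointed_neg : ∀ i, Pointed (sub Z (negPart Z b i))
  pointed_neg_neg : ∀ i, Pointed (-sub Z (negPart Z b i))
  convolvable_plus : ∀ i,
    Convolvable (spline (sub Z (posPart Z b i))) (spline (-sub Z (negPart Z b i)))
  convolvable_minus : ∀ i,
    Convolvable (spline (-sub Z (posPart Z b i))) (spline (sub Z (negPart Z b i)))
  iterConvolvable_R : IterConvolvable r (Rfactor Z b)
  iterConvolvable_T : IterConvolvable r (Tplus Z b)

open Classical in
/-- The list `Z^{B+}`: the list `Z` with the signs of the negative vectors reversed, so that it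
consists of the `P_i` and the `-N_i` (and of the zero vectors of `Z`, if there are any). -/
noncomputable def reorient {r N : ℕ} (Z : Fin N → Vec r) (b : Fin r → Vec r) :
    Fin N → Vec r :=
  fun k => if ∃ i, k ∈ negPart Z b i then -Z k else Z k

/-- The vector `τ = b_1 + c⁻¹ b_2 + ⋯ + c^{-(r-1)} b_r`. -/
noncomputable def tau {r : ℕ} (b : Fin r → Vec r) (c : ℝ) : Vec r :=
  ∑ i : Fin r, (1 / c ^ (i : ℕ)) • b i

/-- The distribution `T` agrees on the open set `C` with the polynomial `p`. -/
def AgreesOn {r : ℕ} (T : Distr r) (p : MvPolynomial (Fin r) ℝ) (C : Set (Vec r)) : Prop :=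
  ∀ φ : Test r, tsupport φ ⊆ C → T φ = polyDistr p φ

/-- `p` is the local piece of `T_1^{B+} * ⋯ * T_r^{B+}` near `τ`: the two agree on an open convex
cone inside `cone(Z^{B+})` that contains `τ` for all large `c`. -/
def IsLocalPieceNearTau {r N : ℕ} (Z : Fin N → Vec r) (b : Fin r → Vec r)
    (p : MvPolynomial (Fin r) ℝ) : Prop :=
  ∃ C : ConvexCone ℝ (Vec r), IsOpen (C : Set (Vec r)) ∧
    (C : Set (Vec r)) ⊆ listCone (reorient Z b) ∧
    (∃ c₀ : ℝ, 0 < c₀ ∧ ∀ c ≥ c₀, tau b c ∈ C) ∧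
    AgreesOn (TB Z b) p C

end ZonotopalSpline

/-!
Along the flag `S_0 ⊂ S_1 ⊂ ⋯ ⊂ S_r` the partial convolution `R_1^B * ⋯ * R_i^B` is a polynomial
density on `S_i`. Up to sign `R_i^B` is `T_Y - (-1)^|Y| T_{-Y}` for the list `Y = (P_i, -N_i)`, all
of whose vectors lie strictly on one side of `S_{i-1}` in `S_i`. Convolving a polynomial density on
`S_{i-1}` with `T_Y` first spreads it constantly along the first vector of `Y` and then integrates
it along each of the others up to `S_{i-1}`, which keeps it polynomial and raises the degree by one
each time. The same formulas with `-Y` give, up to sign, the same polynomial on the other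
half-space, and the sign in `R_i^B` is the one that makes both halves agree.

Near `τ_c` only the positive half-space is seen at every step, so that there the polynomial is also
the density of `T_1^{B+} * ⋯ * T_r^{B+}`. It is not zero, because `τ_c` lies in the support of that
spline.
-/

namespace ZonotopalSpline

/-! ### Test functions, supports and convolutions -/

section Distributions

variable {r : ℕ} {S T R : Distr r}

theorem distrOfDensity_apply {μ : Measure (Vec r)} {f : Vec r → ℝ}
    (hf : LocallyIntegrable f μ) (φ : Test r) : distrOfDensity μ f φ = ∫ x, φ x * f x ∂μ :=
  TestFunction.integralAgainstBilinCLM_eq_integral (B := ContinuousLinearMap.mul ℝ ℝ)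
    (hf.locallyIntegrableOn _)

/-- The product of a smooth function and a test function, as a test function. -/
noncomputable def smoothMul (χ : Vec r → ℝ) (hχ : ContDiff ℝ (⊤ : ℕ∞) χ) (φ : Test r) :
    Test r where
  toFun x := χ x * φ x
  contDiff' := hχ.mul φ.contDiff
  hasCompactSupport' := φ.hasCompactSupport.mul_left
  tsupport_subset' := fun _ _ => trivial

@[simp]
theorem smoothMul_apply (χ : Vec r → ℝ) (hχ : ContDiff ℝ (⊤ : ℕ∞) χ) (φ : Test r) (x : Vec r) :
    smoothMul χ hχ φ x = χ x * φ x := rfl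

/-- A smooth bump function, as a test function. -/
noncomputable def bumpTest {c : Vec r} (f : ContDiffBump c) : Test r where
  toFun := f
  contDiff' := f.contDiff
  hasCompactSupport' := f.hasCompactSupport
  tsupport_subset' := fun _ _ => trivial

theorem exists_test_eq_one_nhdsSet {K : Set (Vec r)} (hK : Bornology.IsBounded K) :
    ∃ α : Test r, ∀ᶠ x in 𝓝ˢ K, α x = 1 := by
  obtain ⟨ρ, hρ⟩ := hK.subset_ball 0
  let f : ContDiffBump (0 : Vec r) := ⟨|ρ| + 1, |ρ| + 2, by positivity, by linarith⟩
  refine ⟨bumpTest f, eventually_nhdsSet_iff_exists.2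
    ⟨Metric.ball 0 ρ, Metric.isOpen_ball, hρ, fun x hx => f.one_of_mem_closedBall ?_⟩⟩
  exact (Metric.mem_ball.1 hx).le.trans ((le_abs_self ρ).trans (lt_add_one _).le)

theorem exists_smoothMul_eq_zero_of_notMem_dsupport {x : Vec r}
    (hx : x ∉ Distribution.dsupport T) :
    ∃ (χ : Vec r → ℝ) (hχ : ContDiff ℝ (⊤ : ℕ∞) χ), χ =ᶠ[𝓝 x] 1 ∧
      ∀ ψ : Test r, T (smoothMul χ hχ ψ) = 0 := by
  obtain ⟨s, hs, hso, hxs⟩ := (Distribution.notMem_dsupport_iff x).1 hx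
  obtain ⟨ε, hε, hεs⟩ := Metric.isOpen_iff.1 hso x hxs
  let f : ContDiffBump x := ⟨ε / 4, ε / 2, by linarith, by linarith⟩
  refine ⟨f, f.contDiff, f.eventuallyEq_one, fun ψ => hs _ ?_⟩
  calc tsupport (smoothMul f f.contDiff ψ)
    _ ⊆ tsupport f := tsupport_mul_subset_left
    _ = Metric.closedBall x (ε / 2) := f.tsupport_eq
    _ ⊆ Metric.ball x ε := Metric.closedBall_subset_ball (half_lt_self hε)
    _ ⊆ s := hεs

theorem exists_smoothMul_eq_zero_of_disjoint {K : Set (Vec r)} (hK : IsCompact K)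
    (hKT : Disjoint K (Distribution.dsupport T)) :
    ∃ (χ : Vec r → ℝ) (hχ : ContDiff ℝ (⊤ : ℕ∞) χ), (∀ x ∈ K, χ x = 1) ∧
      ∀ ψ : Test r, T (smoothMul χ hχ ψ) = 0 := by
  refine hK.induction_on (p := fun s => ∃ (χ : Vec r → ℝ) (hχ : ContDiff ℝ (⊤ : ℕ∞) χ),
    (∀ x ∈ s, χ x = 1) ∧ ∀ ψ : Test r, T (smoothMul χ hχ ψ) = 0) ?_ ?_ ?_ ?_
  · refine ⟨0, contDiff_const, by simp, fun ψ => ?_⟩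
    rw [show smoothMul 0 contDiff_const ψ = 0 by ext; simp, map_zero]
  · rintro s t hst ⟨χ, hχ, hχt, hTχ⟩
    exact ⟨χ, hχ, fun x hx => hχt x (hst hx), hTχ⟩
  · rintro s t ⟨χ, hχ, hχs, hTχ⟩ ⟨θ, hθ, hθt, hTθ⟩
    -- `χ + θ - χ * θ = 1 - (1 - χ) * (1 - θ)`
    refine ⟨χ + θ - χ * θ, (hχ.add hθ).sub (hχ.mul hθ), ?_, fun ψ => ?_⟩
    · rintro x (hx | hx)
      · simp [hχs x hx]
      · simp [hθt x hx]
    · have h : smoothMul (χ + θ - χ * θ) ((hχ.add hθ).sub (hχ.mul hθ)) ψ =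
          smoothMul χ hχ ψ + smoothMul θ hθ ψ - smoothMul χ hχ (smoothMul θ hθ ψ) := by
        ext x
        simp only [smoothMul_apply, Pi.add_apply, Pi.sub_apply, Pi.mul_apply,
          FunLike.coe_add, FunLike.coe_sub]
        ring
      rw [h, map_sub, map_add, hTχ, hTθ, hTχ, add_zero, sub_zero]
  · intro x hx
    obtain ⟨χ, hχ, hχx, hTχ⟩ :=
      exists_smoothMul_eq_zero_of_notMem_dsupport (hKT.notMem_of_mem_left hx)
    exact ⟨{y | χ y = 1}, mem_nhdsWithin_of_mem_nhds hχx, χ, hχ, fun y hy => hy, hTχ⟩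

theorem apply_eq_zero_of_disjoint_dsupport {φ : Test r}
    (h : Disjoint (tsupport φ) (Distribution.dsupport T)) : T φ = 0 := by
  obtain ⟨χ, hχ, hχφ, hTχ⟩ :=
    exists_smoothMul_eq_zero_of_disjoint φ.hasCompactSupport.isCompact h
  have hφ : smoothMul χ hχ φ = φ := by
    ext x
    by_cases hx : x ∈ tsupport φ
    · simp [hχφ x hx]
    · simp [image_eq_zero_of_notMem_tsupport hx]
  rw [← hφ, hTχ]

theorem apply_translate_eq_zero {φ : Test r} {ξ : Vec r}
    (h : ξ ∉ tsupport φ - Distribution.dsupport T) : T (translate ξ φ) = 0 := by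
  refine apply_eq_zero_of_disjoint_dsupport (Set.disjoint_left.2 fun η hη hηT => h ?_)
  have hξη : ξ + η ∈ tsupport φ :=
    tsupport_comp_subset_preimage φ (f := fun η => ξ + η) (by fun_prop) hη
  exact ⟨ξ + η, hξη, η, hηT, add_sub_cancel_right ξ η⟩

theorem dsupport_subset_of_forall {A : Set (Vec r)} (hA : IsClosed A)
    (h : ∀ φ : Test r, (∀ x ∈ A, φ x = 0) → T φ = 0) : Distribution.dsupport T ⊆ A :=
  Set.sInter_subset_of_mem ⟨fun φ hφ => h φ fun _ hx =>
    image_eq_zero_of_notMem_tsupport fun hx' => hφ hx' hx, hA⟩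

theorem isClosed_sub_dsupport (T : Distr r) {K : Set (Vec r)} (hK : IsCompact K) :
    IsClosed (K - Distribution.dsupport T) := by
  rw [sub_eq_add_neg]
  exact Distribution.isClosed_dsupport.neg.add_left_of_isCompact hK

theorem apply_eq_of_isCutoff {φ α β ψ ψ' : Test r} (hα : IsCutoff S T φ α) (hβ : IsCutoff S T φ β)
    (hψ : IsPartialValue T φ α ψ) (hψ' : IsPartialValue T φ β ψ') : S ψ = S ψ' := by
  rw [← sub_eq_zero, ← map_sub]
  refine apply_eq_zero_of_disjoint_dsupport (Set.disjoint_left.2 fun ξ hξ hξS => ?_)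
  refine notMem_tsupport_iff_eventuallyEq.2 ?_ hξ
  have hsub (y : Vec r) : (ψ - ψ') y = α y * T (translate y φ) - β y * T (translate y φ) := by
    rw [FunLike.coe_sub, Pi.sub_apply, hψ, hψ', map_smul, map_smul, smul_eq_mul, smul_eq_mul]
  by_cases h : ξ ∈ tsupport φ - Distribution.dsupport T
  · filter_upwards [hα.filter_mono (nhds_le_nhdsSet (Set.mem_inter hξS h)),
      hβ.filter_mono (nhds_le_nhdsSet (Set.mem_inter hξS h))] with y hy hy'
    rw [hsub, hy, hy', sub_self, Pi.zero_apply]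
  · filter_upwards [(isClosed_sub_dsupport T φ.hasCompactSupport.isCompact).isOpen_compl.mem_nhds h]
      with y hy
    rw [hsub, apply_translate_eq_zero hy, mul_zero, mul_zero, sub_self, Pi.zero_apply]

theorem isConvolution_of_dsupport_subset {A B : Set (Vec r)}
    (hA : Distribution.dsupport S ⊆ A) (hB : Distribution.dsupport T ⊆ B)
    (hAB : ∀ K : Set (Vec r), IsCompact K → Bornology.IsBounded (A ∩ (K - B)))
    (hT : ∀ φ : Test r, ContDiff ℝ (⊤ : ℕ∞) fun ξ => T (translate ξ φ))
    (hR : ∀ φ ψ : Test r, (∀ ξ ∈ A, ψ ξ = T (translate ξ φ)) → R φ = S ψ) :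
    IsConvolution S T R := by
  have hsub (K : Set (Vec r)) :
      Distribution.dsupport S ∩ (K - Distribution.dsupport T) ⊆ A ∩ (K - B) :=
    Set.inter_subset_inter hA (Set.sub_subset_sub_left hB)
  have hcutoff (φ : Test r) : ∃ α : Test r, ∀ᶠ ξ in 𝓝ˢ (A ∩ (tsupport φ - B)), α ξ = 1 :=
    exists_test_eq_one_nhdsSet (hAB _ φ.hasCompactSupport.isCompact)
  have hpartial (φ α : Test r) : IsPartialValue T φ α (smoothMul _ (hT φ) α) := fun ξ => by
    rw [map_smul, smoothMul_apply, smul_eq_mul, mul_comm]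
  refine ⟨fun K hK => ?_, fun φ => ?_, fun φ α ψ hα hψ => ?_⟩
  · exact Metric.isCompact_of_isClosed_isBounded
      (Distribution.isClosed_dsupport.inter (isClosed_sub_dsupport T hK))
      ((hAB K hK).subset (hsub K))
  · obtain ⟨α, hα⟩ := hcutoff φ
    exact ⟨α, _, hα.filter_mono (nhdsSet_mono (hsub _)), hpartial φ α⟩
  · obtain ⟨β, hβ⟩ := hcutoff φ
    rw [apply_eq_of_isCutoff hα (hβ.filter_mono (nhdsSet_mono (hsub _))) hψ (hpartial φ β)]
    refine hR φ _ fun ξ hξ => ?_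
    by_cases h : ξ ∈ tsupport φ - B
    · rw [smoothMul_apply, hβ.self_of_nhdsSet ξ ⟨hξ, h⟩, mul_one]
    · rw [smoothMul_apply, apply_translate_eq_zero fun h' => h (Set.sub_subset_sub_left hB h'),
        zero_mul]

theorem dsupport_smul {c : ℝ} (hc : c ≠ 0) (T : Distr r) :
    Distribution.dsupport (c • T) = Distribution.dsupport T := by
  have h (s : Set (Vec r)) : Distribution.IsVanishingOn (c • T) s ↔
      Distribution.IsVanishingOn T s :=
    forall₂_congr fun φ _ => smul_eq_zero_iff_right hc
  simp only [Distribution.dsupport, h]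

theorem IsConvolution.smul (h : IsConvolution S T R) {c d : ℝ} (hc : c ≠ 0) (hd : d ≠ 0) :
    IsConvolution (c • S) (d • T) ((c * d) • R) := by
  refine ⟨?_, fun φ => ?_, fun φ α ψ hα hψ => ?_⟩
  · simpa only [dsupport_smul hc, dsupport_smul hd] using h.isCompact_inter
  · obtain ⟨α, ψ, hα, hψ⟩ := h.exists_cutoff φ
    refine ⟨α, d • ψ, ?_, fun ξ => congrArg (d • ·) (hψ ξ)⟩
    simpa only [IsCutoff, dsupport_smul hc, dsupport_smul hd] using hα
  · have hα' : IsCutoff S T φ α := by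
      simpa only [IsCutoff, dsupport_smul hc, dsupport_smul hd] using hα
    have hRφ : R φ = S (d⁻¹ • ψ) := h.apply_eq φ α _ hα' fun ξ => by
      rw [FunLike.coe_smul, Pi.smul_apply, hψ ξ]
      exact inv_smul_smul₀ hd _
    calc c * d * R φ = c * (d * (d⁻¹ * S ψ)) := by rw [hRφ, map_smul, smul_eq_mul, mul_assoc]
      _ = c * S ψ := by rw [mul_inv_cancel_left₀ hd]

end Distributions

/-! ### Integration over orthants -/

section OrthantIntegral

variable {E ι κ : Type*} [NormedAddCommGroup E] [NormedSpace ℝ E] [Fintype ι] [Fintype κ]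

/-- The integral of `φ` over the cone with apex `x` spanned by the list `Y`, parametrised by the
orthant: this is the value `(T_Y)_η φ(x + η)`, for functions `φ` on any normed space. -/
noncomputable def orthantIntegral (Y : ι → E) (φ : E → ℝ) (x : E) : ℝ :=
  ∫ w in Set.Ici (0 : ι → ℝ), φ (x + ∑ k, w k • Y k)

theorem orthantIntegral_of_isEmpty [IsEmpty ι] (Y : ι → E) (φ : E → ℝ) (x : E) :
    orthantIntegral Y φ x = φ x := by
  have hIci : Set.Ici (0 : ι → ℝ) = Set.univ := Set.eq_univ_of_forall fun w k => isEmptyElim k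
  simp only [orthantIntegral, Finset.univ_eq_empty, Finset.sum_empty, add_zero, hIci,
    Measure.restrict_univ, integral_const, smul_eq_mul, measureReal_def,
    Measure.volume_pi_eq_dirac (0 : ι → ℝ), measure_univ, ENNReal.toReal_one, one_mul]

theorem orthantIntegral_comp_equiv (σ : κ ≃ ι) (Y : ι → E) :
    orthantIntegral (Y ∘ σ) = orthantIntegral Y := by
  ext φ x
  have h := (volume_measurePreserving_piCongrLeft (fun _ : ι => ℝ) σ).setIntegral_preimage_emb
    (MeasurableEquiv.measurableEmbedding _) (fun w => φ (x + ∑ k, w k • Y k)) (Set.Ici 0)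
  rw [orthantIntegral, orthantIntegral, ← h]
  have happly (w : κ → ℝ) (k : κ) :
      MeasurableEquiv.piCongrLeft (fun _ : ι => ℝ) σ w (σ k) = w k :=
    Equiv.piCongrLeft_apply_apply (fun _ => ℝ) σ w k
  congr 2
  · ext w
    simp only [Set.mem_preimage, Set.mem_Ici, Pi.le_def, ← σ.forall_congr_right, happly,
      Pi.zero_apply]
  · ext w
    simp only [← σ.sum_comp fun k => _ • Y k, happly, Function.comp_apply]

theorem setIntegral_Ici_unique {F : Type*} [NormedAddCommGroup F] [NormedSpace ℝ F] [Unique ι]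
    (g : ℝ → F) :
    ∫ w in Set.Ici (0 : ι → ℝ), g (w default) = ∫ t in Set.Ioi (0 : ℝ), g t := by
  obtain rfl : ‹Fintype ι› = Unique.fintype := Subsingleton.elim _ _
  have hIci : MeasurableEquiv.funUnique ι ℝ ⁻¹' Set.Ici 0 = Set.Ici 0 := by
    ext w
    simp only [Set.mem_preimage, Set.mem_Ici, Pi.le_def, Unique.forall_iff, Pi.zero_apply]
    rfl
  rw [← integral_Ici_eq_integral_Ioi, ← hIci,
    ← (volume_preserving_funUnique ι ℝ).setIntegral_preimage_emb
      (MeasurableEquiv.measurableEmbedding _)]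
  rfl

theorem orthantIntegral_unique [Unique ι] (Y : ι → E) (φ : E → ℝ) (x : E) :
    orthantIntegral Y φ x = ∫ t in Set.Ioi (0 : ℝ), φ (x + t • Y default) := by
  simp only [orthantIntegral, Fintype.sum_unique,
    setIntegral_Ici_unique (ι := ι) fun t => φ (x + t • Y default)]

theorem orthantIntegral_comp_add_const (Y : ι → E) (φ : E → ℝ) (v x : E) :
    orthantIntegral Y (fun z => φ (z + v)) x = orthantIntegral Y φ (x + v) := by
  simp only [orthantIntegral, add_right_comm]

theorem setIntegral_Ici_sum {g : (ι ⊕ κ → ℝ) → ℝ} (hg : IntegrableOn g (Set.Ici 0)) :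
    ∫ w in Set.Ici 0, g w =
      ∫ u in Set.Ici (0 : ι → ℝ), ∫ v in Set.Ici (0 : κ → ℝ), g (Sum.elim u v) := by
  have h := (volume_measurePreserving_sumPiEquivProdPi (fun _ : ι ⊕ κ => ℝ)).symm
  have hemb := (MeasurableEquiv.sumPiEquivProdPi (fun _ : ι ⊕ κ => ℝ)).symm.measurableEmbedding
  have hIci : (MeasurableEquiv.sumPiEquivProdPi (fun _ : ι ⊕ κ => ℝ)).symm ⁻¹' Set.Ici 0 =
      Set.Ici (0 : ι → ℝ) ×ˢ Set.Ici (0 : κ → ℝ) := by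
    ext w
    simp [Pi.le_def, Prod.le_def, MeasurableEquiv.coe_sumPiEquivProdPi_symm]
  rw [← h.setIntegral_preimage_emb hemb, hIci, Measure.volume_eq_prod, setIntegral_prod]
  · rfl
  · rw [← hIci, ← Measure.volume_eq_prod]
    exact (h.integrableOn_comp_preimage hemb).2 hg

theorem exists_isCompact_of_add_sum_mem [FiniteDimensional ℝ E] {l : E →ₗ[ℝ] ℝ} {Y : ι → E}
    (hY : ∀ k, 0 < l (Y k)) {K : Set E} (hK : IsCompact K) :
    ∃ K' : Set (E × (ι → ℝ)), IsCompact K' ∧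
      ∀ x w, 0 ≤ l x → 0 ≤ w → x + ∑ k, w k • Y k ∈ K → (x, w) ∈ K' := by
  obtain ⟨a, ha⟩ := (hK.image l.continuous_of_finiteDimensional).bddAbove
  refine ⟨(fun q : E × (ι → ℝ) => (q.1 - ∑ k, q.2 k • Y k, q.2)) ''
    (K ×ˢ Set.Icc 0 fun k => a / l (Y k)), (hK.prod isCompact_Icc).image (by fun_prop),
    fun x w hx hw hxw => ⟨(_, w), ⟨hxw, hw, fun k => ?_⟩, by simp⟩⟩
  rw [le_div_iff₀ (hY k)]
  calc w k * l (Y k) ≤ ∑ k, w k * l (Y k) :=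
        Finset.single_le_sum (fun j _ => mul_nonneg (hw j) (hY j).le) (Finset.mem_univ k)
    _ ≤ l x + ∑ k, w k * l (Y k) := le_add_of_nonneg_left hx
    _ = l (x + ∑ k, w k • Y k) := by simp only [map_add, map_sum, map_smul, smul_eq_mul]
    _ ≤ a := ha ⟨_, hxw, rfl⟩

theorem integrable_of_ae_eq_zero_off_compact {X : Type*} [TopologicalSpace X] [T2Space X]
    [MeasurableSpace X] [BorelSpace X] {m : Measure X} [IsFiniteMeasureOnCompacts m]
    {F : X → ℝ} (hF : Continuous F) {K : Set X} (hK : IsCompact K)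
    (h : ∀ᵐ x ∂m, x ∉ K → F x = 0) : Integrable F m := by
  refine ((hF.continuousOn.integrableOn_compact hK).integrable_indicator hK.measurableSet).congr ?_
  filter_upwards [h] with x hx
  by_cases hxK : x ∈ K
  · rw [Set.indicator_of_mem hxK]
  · rw [Set.indicator_of_notMem hxK, hx hxK]

variable [FiniteDimensional ℝ E] [MeasurableSpace E] [BorelSpace E] {μ : Measure E}
  [IsFiniteMeasureOnCompacts μ] {l : E →ₗ[ℝ] ℝ} {X : ι → E} {Y : κ → E} {p φ : E → ℝ}

theorem integrable_mul_comp_add_sum (hμ : ∀ᵐ x ∂μ, 0 ≤ l x) (hX : ∀ k, 0 < l (X k))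
    (hp : Continuous p) (hφ : Continuous φ) (hφc : HasCompactSupport φ) :
    Integrable (fun q : E × (ι → ℝ) => p q.1 * φ (q.1 + ∑ k, q.2 k • X k))
      (μ.prod (volume.restrict (Set.Ici 0))) := by
  obtain ⟨K, hK, hmem⟩ := exists_isCompact_of_add_sum_mem hX hφc.isCompact
  refine integrable_of_ae_eq_zero_off_compact (by fun_prop) hK ?_
  filter_upwards [Measure.quasiMeasurePreserving_fst.ae hμ,
    Measure.quasiMeasurePreserving_snd.ae (ae_restrict_mem measurableSet_Ici)] with q hq hq' hqK
  rw [image_eq_zero_of_notMem_tsupport fun h => hqK (hmem _ _ hq hq' h), mul_zero]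

theorem integrable_mul_orthantIntegral (hμ : ∀ᵐ x ∂μ, 0 ≤ l x) (hX : ∀ k, 0 < l (X k))
    (hp : Continuous p) (hφ : Continuous φ) (hφc : HasCompactSupport φ) :
    Integrable (fun x => p x * orthantIntegral X φ x) μ := by
  simpa only [orthantIntegral, integral_const_mul] using
    (integrable_mul_comp_add_sum hμ hX hp hφ hφc).integral_prod_left

theorem integral_mul_orthantIntegral (hμ : ∀ᵐ x ∂μ, 0 ≤ l x) (hX : ∀ k, 0 < l (X k))
    (hp : Continuous p) (hφ : Continuous φ) (hφc : HasCompactSupport φ) :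
    ∫ x, p x * orthantIntegral X φ x ∂μ =
      ∫ w in Set.Ici (0 : ι → ℝ), ∫ x, p x * φ (x + ∑ k, w k • X k) ∂μ := by
  rw [← integral_integral_swap (integrable_mul_comp_add_sum hμ hX hp hφ hφc)]
  simp only [orthantIntegral, integral_const_mul]

theorem integral_mul_orthantIntegral_sumElim (hμ : ∀ᵐ x ∂μ, 0 ≤ l x) (hX : ∀ k, 0 < l (X k))
    (hY : ∀ k, 0 < l (Y k)) (hp : Continuous p) (hφ : Continuous φ) (hφc : HasCompactSupport φ) :
    ∫ x, p x * orthantIntegral (Sum.elim X Y) φ x ∂μ =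
      ∫ w in Set.Ici (0 : ι → ℝ),
        ∫ x, p x * orthantIntegral Y (fun z => φ (z + ∑ k, w k • X k)) x ∂μ := by
  have hXY : ∀ k, 0 < l (Sum.elim X Y k) := Sum.rec hX hY
  rw [integral_mul_orthantIntegral hμ hXY hp hφ hφc,
    setIntegral_Ici_sum (integrable_mul_comp_add_sum hμ hXY hp hφ hφc).integral_prod_right]
  refine integral_congr_ae (.of_forall fun w => ?_)
  dsimp only
  rw [integral_mul_orthantIntegral (φ := fun z => φ (z + ∑ k, w k • X k)) hμ hY hp (by fun_prop)
    (hφc.comp_homeomorph (Homeomorph.addRight _))]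
  simp only [Fintype.sum_sum_type, Sum.elim_inl, Sum.elim_inr, add_assoc,
    add_comm (∑ k, w k • X k)]

theorem orthantIntegral_sumElim (hX : ∀ k, 0 < l (X k)) (hY : ∀ k, 0 < l (Y k))
    (hφ : Continuous φ) (hφc : HasCompactSupport φ) :
    orthantIntegral (Sum.elim X Y) φ 0 = orthantIntegral X (orthantIntegral Y φ) 0 := by
  have h := integral_mul_orthantIntegral_sumElim (μ := Measure.dirac (0 : E)) (p := 1)
    (by simp [ae_dirac_eq]) hX hY continuous_one hφ hφc
  simpa only [Pi.one_apply, one_mul, integral_dirac, orthantIntegral, zero_add, add_comm] using h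

/-- The convolution of the density `p` with respect to `μ` and the spline of the list `X` is the
density `q` with respect to `ν`. -/
def IsConvDensity (μ : Measure E) (p : E → ℝ) (X : ι → E) (ν : Measure E) (q : E → ℝ) : Prop :=
  ∀ φ : E → ℝ, Continuous φ → HasCompactSupport φ →
    ∫ x, p x * orthantIntegral X φ x ∂μ = ∫ z, q z * φ z ∂ν

theorem IsConvDensity.trans {ν ρ : Measure E} [IsFiniteMeasureOnCompacts ν] {q s : E → ℝ}
    (h : IsConvDensity μ p Y ν q) (h' : IsConvDensity ν q X ρ s)
    (hμ : ∀ᵐ x ∂μ, 0 ≤ l x) (hν : ∀ᵐ x ∂ν, 0 ≤ l x) (hX : ∀ k, 0 < l (X k))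
    (hY : ∀ k, 0 < l (Y k)) (hp : Continuous p) (hq : Continuous q) :
    IsConvDensity μ p (Sum.elim X Y) ρ s := by
  intro φ hφ hφc
  rw [integral_mul_orthantIntegral_sumElim hμ hX hY hp hφ hφc, ← h' φ hφ hφc,
    integral_mul_orthantIntegral hν hX hq hφ hφc]
  exact integral_congr_ae (.of_forall fun w =>
    h _ (by fun_prop) (hφc.comp_homeomorph (Homeomorph.addRight _)))

end OrthantIntegral

/-! ### Invariant measures on subspaces -/

theorem setIntegral_prod_Ioo {E : Type*} [MeasurableSpace E] {ν : Measure E} [SFinite ν]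
    {f : E → ℝ} (hf : Measurable f) {H : E × ℝ → ℝ}
    (hH : IntegrableOn H {q | q.2 ∈ Set.Ioo 0 (f q.1)} (ν.prod volume)) :
    ∫ q in {q | q.2 ∈ Set.Ioo 0 (f q.1)}, H q ∂ν.prod volume =
      ∫ z in {z | 0 < f z}, (∫ t in 0..f z, H (z, t)) ∂ν := by
  have hA : MeasurableSet {q : E × ℝ | q.2 ∈ Set.Ioo 0 (f q.1)} :=
    (measurableSet_lt measurable_const measurable_snd).inter
      (measurableSet_lt measurable_snd (hf.comp measurable_fst))
  rw [← integral_indicator hA, integral_prod _ ((integrable_indicator_iff hA).2 hH),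
    ← integral_indicator (measurableSet_lt measurable_const hf)]
  refine integral_congr_ae (.of_forall fun z => ?_)
  change ∫ t, (Set.Ioo 0 (f z)).indicator (fun t => H (z, t)) t = _
  rw [integral_indicator measurableSet_Ioo]
  by_cases hz : 0 < f z
  · rw [Set.indicator_of_mem (show z ∈ {x | 0 < f x} from hz),
      intervalIntegral.integral_of_le hz.le, integral_Ioc_eq_integral_Ioo]
  · simp [hz]

section HaarOn

variable {E : Type*} [NormedAddCommGroup E] [NormedSpace ℝ E] [MeasurableSpace E]
  {S : Submodule ℝ E} {μ ν : Measure E} {l : E →ₗ[ℝ] ℝ} {y : E} {p φ : E → ℝ}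

/-- `μ` is a Lebesgue measure on the subspace `S`, considered as a measure on the whole space. The
normalisation is arbitrary, and `μ = 0` is allowed. -/
structure IsHaarOn (S : Submodule ℝ E) (μ : Measure E) : Prop where
  ae_mem : ∀ᵐ x ∂μ, x ∈ S
  measurePreserving_add : ∀ s ∈ S, MeasurePreserving (s + ·) μ μ
  isFiniteMeasureOnCompacts : IsFiniteMeasureOnCompacts μ

theorem isHaarOn_bot [MeasurableSingletonClass E] :
    IsHaarOn (⊥ : Submodule ℝ E) (Measure.dirac 0) where
  ae_mem := by simp [ae_dirac_eq]
  measurePreserving_add s hs := by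
    simp only [(Submodule.mem_bot ℝ).1 hs, zero_add]
    exact MeasurePreserving.id _
  isFiniteMeasureOnCompacts := inferInstance

theorem IsHaarOn.isAddLeftInvariant (hμ : IsHaarOn (⊤ : Submodule ℝ E) μ) :
    μ.IsAddLeftInvariant :=
  ⟨fun s => (hμ.measurePreserving_add s Submodule.mem_top).map_eq⟩

theorem IsHaarOn.ae_coord_eq_zero (hμ : IsHaarOn (S ⊓ LinearMap.ker l) μ) : ∀ᵐ x ∂μ, l x = 0 := by
  filter_upwards [hμ.ae_mem] with x hx using hx.2

/-- The image of the product of `μ` and Lebesgue measure under `(x, t) ↦ x + t • y`: if `μ` is a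
Lebesgue measure on `S` and `y ∉ S`, this is one on `S + ℝ y`. -/
noncomputable def extendAlong (μ : Measure E) (y : E) : Measure E :=
  (μ.prod volume).map fun q : E × ℝ => q.1 + q.2 • y

variable [BorelSpace E]

theorem measurable_add_smul (y : E) : Measurable fun q : E × ℝ => q.1 + q.2 • y :=
  Continuous.measurable (by fun_prop)

theorem extendAlong_neg [SFinite μ] (y : E) : extendAlong μ (-y) = extendAlong μ y := by
  have h := (MeasurePreserving.id μ).prod (Measure.measurePreserving_neg (volume : Measure ℝ))
  rw [extendAlong, extendAlong, ← h.map_eq,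
    Measure.map_map (measurable_add_smul y) h.measurable, h.map_eq]
  congr 1
  ext q
  simp

theorem extendAlong_smul [SFinite μ] {s : ℝ} (hs : s * s = 1) (y : E) :
    extendAlong μ (s • y) = extendAlong μ y := by
  rcases mul_self_eq_one_iff.1 hs with rfl | rfl
  · rw [one_smul]
  · rw [neg_one_smul, extendAlong_neg]

variable [FiniteDimensional ℝ E]

theorem IsHaarOn.extendAlong (hμ : IsHaarOn (S ⊓ LinearMap.ker l) μ) (hyS : y ∈ S)
    (hy : l y ≠ 0) : IsHaarOn S (extendAlong μ y) := by
  have := hμ.isFiniteMeasureOnCompacts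
  refine ⟨?_, fun s hs => ⟨measurable_const_add s, ?_⟩, ⟨fun K hK => ?_⟩⟩
  · refine (ae_map_iff (measurable_add_smul y).aemeasurable
      S.closed_of_finiteDimensional.measurableSet).2 ?_
    filter_upwards [Measure.quasiMeasurePreserving_fst.ae hμ.ae_mem] with q hq
    exact S.add_mem hq.1 (S.smul_mem _ hyS)
  · have hs' : s - (l s / l y) • y ∈ S ⊓ LinearMap.ker l :=
      ⟨S.sub_mem hs (S.smul_mem _ hyS), by simp [hy]⟩
    have h := (hμ.measurePreserving_add _ hs').prod
      (measurePreserving_add_left (volume : Measure ℝ) (l s / l y))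
    rw [ZonotopalSpline.extendAlong, Measure.map_map (measurable_const_add _)
      (measurable_add_smul y)]
    conv_rhs => rw [← h.map_eq, Measure.map_map (measurable_add_smul y) h.measurable]
    congr 1
    ext q
    simp only [Function.comp_apply, Prod.map]
    module
  · have hl : Continuous l := l.continuous_of_finiteDimensional
    let g (z : E) : E × ℝ := (z - (l z / l y) • y, l z / l y)
    have hgK : IsCompact (g '' K) := hK.image (by fun_prop)
    rw [ZonotopalSpline.extendAlong, Measure.map_apply (measurable_add_smul y) hK.measurableSet]
    refine (measure_mono_ae ?_).trans_lt hgK.measure_lt_top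
    filter_upwards [Measure.quasiMeasurePreserving_fst.ae hμ.ae_coord_eq_zero] with q hq hqK
    refine ⟨_, hqK, ?_⟩
    simp [g, hq, hy]

theorem integrable_mul_comp_add_smul [IsFiniteMeasureOnCompacts μ] (hμ : ∀ᵐ x ∂μ, 0 ≤ l x)
    (hy : 0 < l y) (hp : Continuous p) (hφ : Continuous φ) (hφc : HasCompactSupport φ) :
    Integrable (fun q : E × ℝ => p q.1 * φ (q.1 + q.2 • y))
      (μ.prod (volume.restrict (Set.Ioi 0))) := by
  obtain ⟨K, hK, hmem⟩ :=
    exists_isCompact_of_add_sum_mem (Y := fun _ : Unit => y) (fun _ => hy) hφc.isCompact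
  refine integrable_of_ae_eq_zero_off_compact (by fun_prop)
    (hK.image (f := fun q => (q.1, q.2 ())) (by fun_prop)) ?_
  filter_upwards [Measure.quasiMeasurePreserving_fst.ae hμ,
    Measure.quasiMeasurePreserving_snd.ae (ae_restrict_mem measurableSet_Ioi)] with q hq hq' hqK
  have hq'' : (0 : Unit → ℝ) ≤ fun _ => q.2 := fun _ => le_of_lt hq'
  have hnot : q.1 + q.2 • y ∉ tsupport φ := fun h =>
    hqK ⟨_, hmem _ _ hq hq'' (by simpa using h), rfl⟩
  rw [image_eq_zero_of_notMem_tsupport hnot, mul_zero]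

theorem IsHaarOn.measurePreserving_shear (hν : IsHaarOn S ν) (hyS : y ∈ S) :
    MeasurePreserving (fun q : E × ℝ => (q.1 + q.2 • y, q.2)) (ν.prod volume)
      (ν.prod volume) := by
  have := hν.isFiniteMeasureOnCompacts
  have h : MeasurePreserving (fun q : ℝ × E => (q.1, q.1 • y + q.2)) (volume.prod ν)
      (volume.prod ν) :=
    (MeasurePreserving.id volume).skew_product (g := fun t x => t • y + x)
      (Continuous.measurable (by fun_prop))
      (.of_forall fun t => (hν.measurePreserving_add _ (S.smul_mem t hyS)).map_eq)
  have h' := Measure.measurePreserving_swap.comp (h.comp (Measure.measurePreserving_swap (μ := ν)))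
  simpa only [Function.comp_def, Prod.swap, add_comm] using h'

theorem isConvDensity_halfSpace (hν : IsHaarOn S ν) (hyS : y ∈ S) (hy : 0 < l y)
    (hp : Continuous p) :
    IsConvDensity (ν.restrict {x | 0 < l x}) p (fun _ : Unit => y) (ν.restrict {x | 0 < l x})
      fun z => ∫ t in 0..l z / l y, p (z - t • y) := by
  intro φ hφ hφc
  have := hν.isFiniteMeasureOnCompacts
  have hl : Continuous l := l.continuous_of_finiteDimensional
  have hpos : MeasurableSet {x | 0 < l x} := (isOpen_lt continuous_const hl).measurableSet
  let H (q : E × ℝ) : ℝ := p (q.1 - q.2 • y) * φ q.1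
  let A : Set (E × ℝ) := {q | q.2 ∈ Set.Ioo 0 (l q.1 / l y)}
  have hA : MeasurableSet A := ((isOpen_lt continuous_const continuous_snd).inter
    (isOpen_lt continuous_snd (by fun_prop))).measurableSet
  have hshear := (hν.measurePreserving_shear hyS).restrict_preimage hA
  have hpre : (fun q : E × ℝ => (q.1 + q.2 • y, q.2)) ⁻¹' A = {x | 0 < l x} ×ˢ Set.Ioi 0 := by
    ext q
    simp [A, lt_div_iff₀ hy, and_comm]
  rw [hpre, ← Measure.prod_restrict] at hshear
  have hHm : AEStronglyMeasurable H ((ν.prod volume).restrict A) :=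
    Continuous.aestronglyMeasurable (by fun_prop)
  have hF := integrable_mul_comp_add_smul (μ := ν.restrict {x | 0 < l x})
    (ae_restrict_of_forall_mem hpos fun x hx => le_of_lt hx)
    hy hp hφ hφc
  have hHG : ∀ q : E × ℝ, p q.1 * φ (q.1 + q.2 • y) = H (q.1 + q.2 • y, q.2) := by simp [H]
  have hHint : IntegrableOn H A (ν.prod volume) :=
    (hshear.integrable_comp hHm).1 (hF.congr (.of_forall hHG))
  calc ∫ x in {x | 0 < l x}, p x * orthantIntegral (fun _ : Unit => y) φ x ∂ν
      = ∫ q in A, H q ∂ν.prod volume := by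
        simp only [orthantIntegral_unique, ← integral_const_mul]
        rw [integral_integral hF, ← hshear.map_eq, integral_map hshear.aemeasurable
          (hshear.map_eq ▸ hHm)]
        simp only [hHG]
    _ = ∫ z in {z | 0 < l z}, (∫ t in 0..l z / l y, p (z - t • y)) * φ z ∂ν := by
        rw [setIntegral_prod_Ioo (f := fun z => l z / l y) (by fun_prop) hHint]
        simp only [H, div_pos_iff_of_pos_right hy, intervalIntegral.integral_mul_const]

theorem isConvDensity_extendAlong [IsFiniteMeasureOnCompacts μ] (hμ : ∀ᵐ x ∂μ, l x = 0)
    (hy : 0 < l y) (hp : Continuous p) :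
    IsConvDensity μ p (fun _ : Unit => y) ((extendAlong μ y).restrict {x | 0 < l x})
      fun z => p (z - (l z / l y) • y) := by
  intro φ hφ hφc
  have hl : Continuous l := l.continuous_of_finiteDimensional
  have hpos : MeasurableSet {x | 0 < l x} := (isOpen_lt continuous_const hl).measurableSet
  have hpre : (fun q : E × ℝ => q.1 + q.2 • y) ⁻¹' {x | 0 < l x} =ᵐ[μ.prod volume]
      Set.univ ×ˢ Set.Ioi 0 := by
    refine Filter.eventuallyEq_set.2 ?_
    filter_upwards [Measure.quasiMeasurePreserving_fst.ae hμ] with q hq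
    simp [hq, hy]
  simp only [orthantIntegral_unique, ← integral_const_mul]
  rw [extendAlong, setIntegral_map hpos (Continuous.aestronglyMeasurable (by fun_prop))
    (measurable_add_smul y).aemeasurable, setIntegral_congr_set hpre, ← Measure.prod_restrict,
    Measure.restrict_univ, integral_integral
    (integrable_mul_comp_add_smul (hμ.mono fun x hx => hx.ge) hy hp hφ hφc)]
  refine integral_congr_ae ?_
  filter_upwards [Measure.quasiMeasurePreserving_fst.ae hμ] with q hq
  simp [hq, hy.ne']

theorem isConvDensity_halfSpace_smul (hν : IsHaarOn S ν) (hyS : y ∈ S) (hy : 0 < l y)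
    (hp : Continuous p) {s : ℝ} (hs : s * s = 1) :
    IsConvDensity (ν.restrict {x | 0 < (s • l) x}) p (fun _ : Unit => s • y)
      (ν.restrict {x | 0 < (s • l) x}) fun z => s * ∫ t in 0..l z / l y, p (z - t • y) := by
  have hly : (s • l) (s • y) = l y := by simp [← mul_assoc, hs]
  convert isConvDensity_halfSpace hν (S.smul_mem s hyS) (hly ▸ hy) hp using 2 with z
  have h := intervalIntegral.mul_integral_comp_mul_left (a := 0) (b := s * (l z / l y))
    (f := fun t => p (z - t • y)) (c := s)
  rw [mul_zero, ← mul_assoc s s, hs, one_mul] at h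
  simp only [hly, ← h, ← mul_assoc, hs, one_mul, LinearMap.smul_apply, smul_eq_mul, mul_div_assoc,
    smul_smul, mul_comm]

theorem isConvDensity_extendAlong_smul [IsFiniteMeasureOnCompacts μ] (hμ : ∀ᵐ x ∂μ, l x = 0)
    (hy : 0 < l y) (hp : Continuous p) {s : ℝ} (hs : s * s = 1) :
    IsConvDensity μ p (fun _ : Unit => s • y) ((extendAlong μ y).restrict {x | 0 < (s • l) x})
      fun z => p (z - (l z / l y) • y) := by
  have hly : (s • l) (s • y) = l y := by simp [← mul_assoc, hs]
  have hμ' : ∀ᵐ x ∂μ, (s • l) x = 0 := hμ.mono fun x hx => by simp [hx]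
  rw [← extendAlong_smul hs]
  convert isConvDensity_extendAlong hμ' (hly ▸ hy) hp using 4 with z
  rw [hly, LinearMap.smul_apply, smul_smul, smul_eq_mul, mul_comm, ← mul_div_assoc, ← mul_assoc, hs,
    one_mul]

theorem ae_restrict_nonneg (ν : Measure E) (l : E →ₗ[ℝ] ℝ) :
    ∀ᵐ x ∂ν.restrict {x | 0 < l x}, 0 ≤ l x :=
  ae_restrict_of_forall_mem
    (isOpen_lt continuous_const l.continuous_of_finiteDimensional).measurableSet
    fun _ hx => le_of_lt hx

theorem ae_extendAlong_coord_ne_zero [SFinite μ] (hμ : ∀ᵐ x ∂μ, l x = 0) (hy : l y ≠ 0) :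
    ∀ᵐ z ∂extendAlong μ y, l z ≠ 0 := by
  have hl : Continuous l := l.continuous_of_finiteDimensional
  refine (ae_map_iff (measurable_add_smul y).aemeasurable
    (hl.measurable (measurableSet_singleton 0).compl)).2 ?_
  filter_upwards [Measure.quasiMeasurePreserving_fst.ae hμ,
    Measure.quasiMeasurePreserving_snd.ae (Measure.ae_ne volume 0)] with q hq hq'
  simpa [hq, hy] using hq'

theorem setIntegral_pos_add_setIntegral_neg_extendAlong [SFinite μ] (hμ : ∀ᵐ x ∂μ, l x = 0)
    (hy : l y ≠ 0) {g : E → ℝ} (hg : Integrable g (extendAlong μ y)) :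
    ∫ z in {z | 0 < l z}, g z ∂extendAlong μ y + ∫ z in {z | l z < 0}, g z ∂extendAlong μ y =
      ∫ z, g z ∂extendAlong μ y := by
  have hhalf : MeasurableSet {z | 0 < l z} :=
    (isOpen_lt continuous_const l.continuous_of_finiteDimensional).measurableSet
  have hcompl : ({z | 0 < l z}ᶜ : Set E) =ᵐ[extendAlong μ y]
      ({z | l z < 0} : Set E) := by
    refine Filter.eventuallyEq_set.2 ?_
    filter_upwards [ae_extendAlong_coord_ne_zero hμ hy] with z hz
    simpa using hz.le_iff_lt
  rw [← setIntegral_congr_set hcompl, integral_add_compl hhalf hg]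

end HaarOn

/-! ### Integrals of homogeneous polynomials along rays -/

section Polynomials

variable {σ : Type*} [Finite σ] {d : ℕ}

theorem exists_isHomogeneous_eval_comp {τ : Type*} {p : MvPolynomial τ ℝ} (hp : p.IsHomogeneous d)
    (π : (σ → ℝ) →ₗ[ℝ] (τ → ℝ)) :
    ∃ q : MvPolynomial σ ℝ, q.IsHomogeneous d ∧
      ∀ z, MvPolynomial.eval z q = MvPolynomial.eval (π z) p := by
  classical
  cases nonempty_fintype σ
  refine ⟨MvPolynomial.aeval (LinearMap.toMatrix' π).toMvPolynomial p, ?_, fun z => ?_⟩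
  · simpa only [one_mul] using hp.aeval _ fun i => Matrix.toMvPolynomial_isHomogeneous _ i
  · refine (MvPolynomial.eval₂Hom_bind₁ (RingHom.id ℝ) z _ p).trans ?_
    congr 2
    ext k
    exact (Matrix.toMvPolynomial_eval_eq_apply _ k z).trans
      (congr_fun (LinearMap.toMatrix'_mulVec π z) k)

theorem exists_isHomogeneous_eval_eq_integral_option {P : MvPolynomial (Option σ) ℝ}
    (hP : P.IsHomogeneous d) (f : (σ → ℝ) →ₗ[ℝ] ℝ) :
    ∃ q : MvPolynomial σ ℝ, q.IsHomogeneous (d + 1) ∧ ∀ z, MvPolynomial.eval z q =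
      ∫ t in 0..f z, MvPolynomial.eval (fun o => o.elim t z) P := by
  cases nonempty_fintype σ
  obtain ⟨F, hF, hFf⟩ := exists_isHomogeneous_eval_comp
    (MvPolynomial.isHomogeneous_X ℝ ()) (LinearMap.pi fun _ : Unit => f)
  simp only [MvPolynomial.eval_X, LinearMap.pi_apply] at hFf
  refine ⟨∑ m ∈ P.support,
    MvPolynomial.monomial m.some (P.coeff m / (m none + 1)) * F ^ (m none + 1), ?_, fun z => ?_⟩
  · refine MvPolynomial.IsHomogeneous.sum _ _ _ fun m hm => ?_
    have hdeg : m.some.degree + 1 * (m none + 1) = d + 1 := by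
      have h : m.degree = d :=
        not_imp_comm.1 (hP.coeff_eq_zero (d := m)) (MvPolynomial.mem_support_iff.1 hm)
      rw [Finsupp.degree_eq_sum, Fintype.sum_option] at h
      simp only [Finsupp.degree_eq_sum, Finsupp.some_apply]
      lia
    exact hdeg ▸ (MvPolynomial.isHomogeneous_monomial _ rfl).mul (hF.pow _)
  · simp only [MvPolynomial.eval_eq' _ P, Fintype.prod_option, Option.elim]
    rw [map_sum, intervalIntegral.integral_finsetSum
      fun m _ => Continuous.intervalIntegrable (by fun_prop) _ _]
    refine Finset.sum_congr rfl fun m _ => ?_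
    rw [intervalIntegral.integral_const_mul, intervalIntegral.integral_mul_const, integral_pow,
      map_mul, map_pow, hFf, MvPolynomial.eval_monomial, Finsupp.prod_fintype _ _ (by simp)]
    simp only [Finsupp.some_apply, zero_pow (Nat.succ_ne_zero _), sub_zero]
    ring

theorem exists_isHomogeneous_eval_eq_integral {p : MvPolynomial σ ℝ} (hp : p.IsHomogeneous d)
    (f : (σ → ℝ) →ₗ[ℝ] ℝ) (y : σ → ℝ) :
    ∃ q : MvPolynomial σ ℝ, q.IsHomogeneous (d + 1) ∧ ∀ z, MvPolynomial.eval z q =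
      ∫ t in 0..f z, MvPolynomial.eval (z - t • y) p := by
  obtain ⟨P, hP, hPp⟩ := exists_isHomogeneous_eval_comp hp (σ := Option σ)
    (LinearMap.funLeft ℝ ℝ some - (LinearMap.proj none).smulRight y)
  obtain ⟨q, hq, hqP⟩ := exists_isHomogeneous_eval_eq_integral_option hP f
  refine ⟨q, hq, fun z => ?_⟩
  simp only [hqP, hPp]
  rfl

end Polynomials

section OrthantIntegral

variable {E ι κ : Type*} [NormedAddCommGroup E] [NormedSpace ℝ E] [Fintype ι] [Fintype κ]
  [MeasurableSpace E] {μ ν : Measure E} {X : ι → E} {p q : E → ℝ}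

theorem isConvDensity_comp_equiv (σ : κ ≃ ι) :
    IsConvDensity μ p (X ∘ σ) ν q ↔ IsConvDensity μ p X ν q := by
  simp only [IsConvDensity, orthantIntegral_comp_equiv]

theorem IsConvDensity.const_mul (h : IsConvDensity μ p X ν q) (c : ℝ) :
    IsConvDensity μ (fun x => c * p x) X ν (fun x => c * q x) := fun φ hφ hφc => by
  simp only [mul_assoc, integral_const_mul, h φ hφ hφc]

theorem IsConvDensity.option [FiniteDimensional ℝ E] [BorelSpace E] [IsFiniteMeasureOnCompacts μ]
    [IsFiniteMeasureOnCompacts ν] {ρ : Measure E} {s : E → ℝ} {l : E →ₗ[ℝ] ℝ} {X : Option ι → E}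
    (h : IsConvDensity μ p (fun _ : Unit => X none) ν q) (h' : IsConvDensity ν q (X ∘ some) ρ s)
    (hμ : ∀ᵐ x ∂μ, 0 ≤ l x) (hν : ∀ᵐ x ∂ν, 0 ≤ l x) (hX : ∀ o, 0 < l (X o))
    (hp : Continuous p) (hq : Continuous q) : IsConvDensity μ p X ρ s := by
  have hsum : X ∘ (Equiv.optionEquivSumPUnit ι).symm =
      Sum.elim (X ∘ some) fun _ : Unit => X none := by
    ext (_ | _) <;> rfl
  rw [← isConvDensity_comp_equiv (Equiv.optionEquivSumPUnit ι).symm, hsum]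
  exact h.trans h' hμ hν (fun k => hX (some k)) (fun _ => hX none) hp hq

end OrthantIntegral

/-! ### Splines of lists in a subspace, with homogeneous polynomial densities -/

section PolynomialDensity

variable {σ ι : Type*} [Fintype σ] [Fintype ι] {S : Submodule ℝ (σ → ℝ)}
  {μ ν : Measure (σ → ℝ)} {l : (σ → ℝ) →ₗ[ℝ] ℝ} {Y : ι → σ → ℝ} {p : MvPolynomial σ ℝ} {d : ℕ}

theorem exists_isConvDensity_halfSpace (hν : IsHaarOn S ν) (hp : p.IsHomogeneous d)
    (hYS : ∀ k, Y k ∈ S) (hY : ∀ k, 0 < l (Y k)) :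
    ∃ q : MvPolynomial σ ℝ, q.IsHomogeneous (d + Fintype.card ι) ∧ ∀ s : ℝ, s * s = 1 →
      IsConvDensity (ν.restrict {x | 0 < (s • l) x}) (fun x => MvPolynomial.eval x p) (s • Y)
        (ν.restrict {x | 0 < (s • l) x})
        fun x => s ^ Fintype.card ι * MvPolynomial.eval x q := by
  have := hν.isFiniteMeasureOnCompacts
  refine Fintype.induction_empty_option (P := fun ι _ => ∀ {Y : ι → σ → ℝ} {p : MvPolynomial σ ℝ}
    {d : ℕ}, p.IsHomogeneous d → (∀ k, Y k ∈ S) → (∀ k, 0 < l (Y k)) →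
      ∃ q : MvPolynomial σ ℝ, q.IsHomogeneous (d + Fintype.card ι) ∧ ∀ s : ℝ, s * s = 1 →
        IsConvDensity (ν.restrict {x | 0 < (s • l) x}) (fun x => MvPolynomial.eval x p) (s • Y)
          (ν.restrict {x | 0 < (s • l) x}) fun x => s ^ Fintype.card ι * MvPolynomial.eval x q)
    ?_ ?_ ?_ ι hp hYS hY
  · intro α β _ σ ih Y p d hp hYS hY
    let := Fintype.ofEquiv β σ.symm
    obtain ⟨q, hq, hqY⟩ := ih (Y := Y ∘ σ) hp (fun k => hYS _) (fun k => hY _)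
    rw [Fintype.card_congr σ] at hq hqY
    exact ⟨q, hq, fun s hs => (isConvDensity_comp_equiv σ).1 (hqY s hs)⟩
  · exact @fun Y p d hp _ _ =>
      ⟨p, hp, fun s _ φ _ _ => by simp [orthantIntegral_of_isEmpty]⟩
  · intro α _ ih Y p d hp hYS hY
    obtain ⟨q₁, hq₁, hq₁Y⟩ := exists_isHomogeneous_eval_eq_integral hp
      ((l (Y none))⁻¹ • l) (Y none)
    obtain ⟨q, hq, hqY⟩ := ih (Y := Y ∘ some) hq₁ (fun k => hYS _) (fun k => hY _)
    have hcard : Fintype.card (Option α) = Fintype.card α + 1 := Fintype.card_option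
    refine ⟨q, by rwa [hcard, add_comm (Fintype.card α), ← add_assoc], fun s hs => ?_⟩
    have hfirst := isConvDensity_halfSpace_smul hν (hYS none) (hY none)
      (MvPolynomial.continuous_eval p) hs
    simp only [LinearMap.smul_apply, smul_eq_mul, inv_mul_eq_div] at hq₁Y
    simp only [← hq₁Y] at hfirst
    simp only [hcard, pow_succ', mul_assoc]
    exact hfirst.option ((hqY s hs).const_mul s) (ae_restrict_nonneg _ _) (ae_restrict_nonneg _ _)
      (fun o => by simpa [← mul_assoc, hs] using hY o) (MvPolynomial.continuous_eval p)
      ((MvPolynomial.continuous_eval q₁).const_smul s)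

theorem exists_isConvDensity_extendAlong (hμ : IsHaarOn (S ⊓ LinearMap.ker l) μ)
    (hp : p.IsHomogeneous d) (hYS : ∀ k, Y k ∈ S) (hY : ∀ k, 0 < l (Y k)) (k₀ : ι) :
    ∃ q : MvPolynomial σ ℝ, q.IsHomogeneous (d + (Fintype.card ι - 1)) ∧ ∀ s : ℝ, s * s = 1 →
      IsConvDensity μ (fun x => MvPolynomial.eval x p) (s • Y)
        ((extendAlong μ (Y k₀)).restrict {x | 0 < (s • l) x})
        fun x => s ^ (Fintype.card ι - 1) * MvPolynomial.eval x q := by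
  classical
  have hν := hμ.extendAlong (hYS k₀) (hY k₀).ne'
  have := hμ.isFiniteMeasureOnCompacts
  have := hν.isFiniteMeasureOnCompacts
  obtain ⟨q₁, hq₁, hq₁p⟩ := exists_isHomogeneous_eval_comp hp
    (LinearMap.id - ((l (Y k₀))⁻¹ • l).smulRight (Y k₀))
  obtain ⟨q, hq, hqY⟩ := exists_isConvDensity_halfSpace (Y := fun k : {k // k ≠ k₀} => Y k) hν hq₁
    (fun k => hYS _) (fun k => hY _)
  have hcard : Fintype.card {k // k ≠ k₀} = Fintype.card ι - 1 := by simp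
  rw [hcard] at hq hqY
  refine ⟨q, hq, fun s hs => (isConvDensity_comp_equiv (Equiv.optionSubtypeNe k₀)).1 ?_⟩
  have hfirst := isConvDensity_extendAlong_smul hμ.ae_coord_eq_zero (hY k₀)
    (MvPolynomial.continuous_eval p) hs
  have hπ (z : σ → ℝ) : MvPolynomial.eval (z - (l z / l (Y k₀)) • Y k₀) p =
      MvPolynomial.eval z q₁ := by
    simp [hq₁p, inv_mul_eq_div]
  simp only [hπ] at hfirst
  exact hfirst.option (hqY s hs) (hμ.ae_coord_eq_zero.mono fun x hx => by simp [hx])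
    (ae_restrict_nonneg _ _) (fun o => by simpa [← mul_assoc, hs] using hY _)
    (MvPolynomial.continuous_eval p) (MvPolynomial.continuous_eval q₁)

/-- The two half-spaces carry the same polynomial because `(-1)^|Y| * (-1)^(|Y| - 1) = -1`: one sign
stands in front of `T_{-Y}`, the other comes from `|Y| - 1` integrations in the direction `-Y`. -/
theorem exists_isConvDensity_integral_sub (hμ : IsHaarOn (S ⊓ LinearMap.ker l) μ)
    (hp : p.IsHomogeneous d) (hYS : ∀ k, Y k ∈ S) (hY : ∀ k, 0 < l (Y k)) (k₀ : ι) :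
    ∃ q : MvPolynomial σ ℝ, q.IsHomogeneous (d + (Fintype.card ι - 1)) ∧
      IsConvDensity μ (fun x => MvPolynomial.eval x p) Y
        ((extendAlong μ (Y k₀)).restrict {x | 0 < l x}) (fun x => MvPolynomial.eval x q) ∧
      ∀ φ : (σ → ℝ) → ℝ, Continuous φ → HasCompactSupport φ →
        ∫ x, MvPolynomial.eval x p * (orthantIntegral Y φ x -
          (-1) ^ Fintype.card ι * orthantIntegral (-Y) φ x) ∂μ =
        ∫ z, MvPolynomial.eval z q * φ z ∂extendAlong μ (Y k₀) := by
  have hμ₀ := hμ.ae_coord_eq_zero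
  have := hμ.isFiniteMeasureOnCompacts
  have hν := (hμ.extendAlong (hYS k₀) (hY k₀).ne').isFiniteMeasureOnCompacts
  have hp' := MvPolynomial.continuous_eval p
  obtain ⟨q, hq, hqY⟩ := exists_isConvDensity_extendAlong hμ hp hYS hY k₀
  have hpos := hqY 1 (one_mul 1)
  have hneg := hqY (-1) (by norm_num)
  simp only [one_smul, one_pow, one_mul] at hpos
  simp only [neg_smul, one_smul, LinearMap.smul_apply, smul_eq_mul, neg_one_mul, neg_pos] at hneg
  refine ⟨q, hq, hpos, fun φ hφ hφc => ?_⟩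
  have hsign : (-1 : ℝ) ^ Fintype.card ι * (-1) ^ (Fintype.card ι - 1) = -1 := by
    have := Fintype.card_pos_iff.2 ⟨k₀⟩
    rw [← pow_add, Odd.neg_one_pow ⟨Fintype.card ι - 1, by lia⟩]
  have hint : Integrable (fun z => MvPolynomial.eval z q * φ z) (extendAlong μ (Y k₀)) :=
    ((MvPolynomial.continuous_eval q).mul hφ).integrable_of_hasCompactSupport hφc.mul_left
  calc
    _ = ∫ x, MvPolynomial.eval x p * orthantIntegral Y φ x ∂μ -
        (-1) ^ Fintype.card ι * ∫ x, MvPolynomial.eval x p * orthantIntegral (-Y) φ x ∂μ := by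
      rw [← integral_const_mul, ← integral_sub
        (integrable_mul_orthantIntegral (hμ₀.mono fun _ h => h.ge) hY hp' hφ hφc)
        ((integrable_mul_orthantIntegral (l := -l) (hμ₀.mono fun x h => by simp [h])
          (by simpa using hY) hp' hφ hφc).const_mul _)]
      simp only [mul_sub, mul_left_comm]
    _ = (∫ z in {z | 0 < l z}, MvPolynomial.eval z q * φ z ∂extendAlong μ (Y k₀)) +
        ∫ z in {z | l z < 0}, MvPolynomial.eval z q * φ z ∂extendAlong μ (Y k₀) := by
      rw [hpos φ hφ hφc, hneg φ hφ hφc]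
      simp only [mul_assoc, integral_const_mul]
      rw [← mul_assoc, hsign, neg_one_mul, sub_neg_eq_add]
    _ = _ := setIntegral_pos_add_setIntegral_neg_extendAlong hμ₀ (hY k₀).ne' hint

end PolynomialDensity

/-! ### Splines and their convolutions -/

section NormCone

variable {E ι : Type*} [NormedAddCommGroup E]

/-- The cone `‖x‖ ≤ M * f x`. For large `M` it contains the cone of a finite list on which the
linear functional `f` is positive; it is used with `f` and `|f|` to bound supports. -/
def normCone (f : E → ℝ) (M : ℝ) : Set E := {x | ‖x‖ ≤ M * f x}

theorem isClosed_normCone {f : E → ℝ} (hf : Continuous f) (M : ℝ) : IsClosed (normCone f M) :=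
  isClosed_le continuous_norm (continuous_const.mul hf)

theorem nonneg_of_mem_normCone {f : E → ℝ} {M : ℝ} (hM : 0 < M) {x : E} (hx : x ∈ normCone f M) :
    0 ≤ f x :=
  nonneg_of_mul_nonneg_right ((norm_nonneg x).trans hx) hM

variable [NormedSpace ℝ E] {l : E →ₗ[ℝ] ℝ} {X : ι → E} {M : ℝ}

theorem exists_forall_mem_normCone [Finite ι] (hX : ∀ k, 0 < l (X k)) :
    ∃ M : ℝ, 0 < M ∧ ∀ k, X k ∈ normCone l M := by
  obtain ⟨M, hM⟩ := (Set.finite_range fun k => ‖X k‖ / l (X k)).bddAbove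
  refine ⟨max M 1, by positivity, fun k => (div_le_iff₀ (hX k)).1 ?_⟩
  exact (hM ⟨k, rfl⟩).trans (le_max_left M 1)

theorem sum_smul_mem_normCone [Fintype ι] (hX : ∀ k, X k ∈ normCone l M) {w : ι → ℝ}
    (hw : 0 ≤ w) : ∑ k, w k • X k ∈ normCone l M := by
  calc ‖∑ k, w k • X k‖ ≤ ∑ k, ‖w k • X k‖ := norm_sum_le _ _
    _ ≤ ∑ k, w k * (M * l (X k)) := Finset.sum_le_sum fun k _ => by
      rw [norm_smul, Real.norm_of_nonneg (hw k)]
      exact mul_le_mul_of_nonneg_left (hX k) (hw k)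
    _ = M * l (∑ k, w k • X k) := by
      simp only [map_sum, map_smul, smul_eq_mul, Finset.mul_sum, mul_left_comm]

theorem normCone_subset_normCone_abs (hM : 0 < M) :
    normCone l M ⊆ normCone (fun x => |l x|) M := fun _ hx =>
  hx.trans (mul_le_mul_of_nonneg_left (le_abs_self _) hM.le)

variable [FiniteDimensional ℝ E]

theorem isBounded_normCone_inter_sub {M' : ℝ} (hM : 0 < M) (hM' : 0 < M') {K : Set E}
    (hK : IsCompact K) : Bornology.IsBounded (normCone l M ∩ (K - normCone l M')) := by
  obtain ⟨a, ha⟩ := (hK.image l.continuous_of_finiteDimensional).bddAbove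
  refine (Metric.isBounded_closedBall (x := (0 : E)) (r := M * a)).subset ?_
  rintro _ ⟨hx, k, hk, y, hy, rfl⟩
  refine mem_closedBall_zero_iff.2 (hx.trans (mul_le_mul_of_nonneg_left ?_ hM.le))
  have hka : l k ≤ a := ha ⟨k, hk, rfl⟩
  rw [map_sub]
  linarith [nonneg_of_mem_normCone hM' hy]

theorem isBounded_ker_inter_sub (l : E →ₗ[ℝ] ℝ) (M : ℝ) {K : Set E} (hK : IsCompact K) :
    Bornology.IsBounded ((LinearMap.ker l : Set E) ∩ (K - normCone (fun x => |l x|) M)) := by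
  obtain ⟨a, ha⟩ := (hK.image
    (l.continuous_of_finiteDimensional.abs.const_smul M)).bddAbove
  obtain ⟨R, hR⟩ := hK.isBounded.subset_closedBall 0
  refine (Metric.isBounded_closedBall (x := (0 : E)) (r := R + a)).subset ?_
  rintro _ ⟨hx, k, hk, y, hy, rfl⟩
  have hky : l k = l y := sub_eq_zero.1 ((map_sub l k y).symm.trans hx)
  have hya : M * |l y| ≤ a := hky ▸ ha ⟨k, hk, rfl⟩
  rw [mem_closedBall_zero_iff]
  exact (norm_sub_le k y).trans
    (add_le_add (mem_closedBall_zero_iff.1 (hR hk)) (le_trans hy hya))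

end NormCone

section Splines

variable {r : ℕ} {ι κ : Type*} {X : ι → Vec r}

theorem Pointed.neg (hX : Pointed X) : Pointed (-X) := by
  obtain ⟨f, hf⟩ := hX
  exact ⟨-f, fun k => by simpa using hf k⟩

theorem Pointed.sumElim [Finite κ] {Y : κ → Vec r} {l : Vec r →ₗ[ℝ] ℝ} (hX : Pointed X)
    (hXl : ∀ k, l (X k) = 0) (hY : ∀ k, 0 < l (Y k)) : Pointed (Sum.elim X Y) := by
  obtain ⟨f, hf⟩ := hX
  obtain ⟨M, hM⟩ := (Set.finite_range fun k => -f (Y k) / l (Y k)).bddAbove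
  refine ⟨f + (M + 1) • l, Sum.rec (fun k => ?_) fun k => ?_⟩
  · simpa [hXl k] using hf k
  · have hk : -f (Y k) ≤ M * l (Y k) := (div_le_iff₀ (hY k)).1 (hM ⟨k, rfl⟩)
    simp only [Sum.elim_inr, LinearMap.add_apply, LinearMap.smul_apply, smul_eq_mul]
    linarith [hY k]

variable [Fintype ι] [Fintype κ] {Y : κ → Vec r} {l : Vec r →ₗ[ℝ] ℝ} {M : ℝ}

theorem spline_translate (hX : Pointed X) (φ : Test r) (ξ : Vec r) :
    spline X (translate ξ φ) = orthantIntegral X φ ξ :=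
  spline_apply hX _

theorem spline_eq_orthantIntegral (hX : Pointed X) (φ : Test r) :
    spline X φ = orthantIntegral X φ 0 := by
  simp only [spline_apply hX, orthantIntegral, zero_add]

theorem spline_eq_zero (hX : Pointed X) (hM : ∀ k, X k ∈ normCone l M) {φ : Test r}
    (hφ : ∀ x ∈ normCone l M, φ x = 0) : spline X φ = 0 := by
  rw [spline_apply hX]
  exact setIntegral_eq_zero_of_forall_eq_zero fun w hw => hφ _ (sum_smul_mem_normCone hM hw)

theorem dsupport_spline_subset (hX : Pointed X) (hM : ∀ k, X k ∈ normCone l M) :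
    Distribution.dsupport (spline X) ⊆ normCone l M :=
  dsupport_subset_of_forall (isClosed_normCone l.continuous_of_finiteDimensional M)
    fun _ => spline_eq_zero hX hM

theorem integrableOn_comp_sum_smul (hX : ∀ k, 0 < l (X k)) {φ : Vec r → ℝ} (hφ : Continuous φ)
    (hφc : HasCompactSupport φ) :
    IntegrableOn (fun w : ι → ℝ => φ (∑ k, w k • X k)) (Set.Ici 0) := by
  simpa [IntegrableOn] using (integrable_mul_comp_add_sum (μ := Measure.dirac (0 : Vec r))
    (p := 1) (by simp [ae_dirac_eq]) hX continuous_one hφ hφc).integral_prod_right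

theorem listCone_subset_dsupport_spline (hX : Pointed X) :
    listCone X ⊆ Distribution.dsupport (spline X) := by
  rintro _ ⟨w, hw, rfl⟩
  by_contra hx
  obtain ⟨s, hs, hso, hxs⟩ := (Distribution.notMem_dsupport_iff _).1 hx
  obtain ⟨ε, hε, hεs⟩ := Metric.isOpen_iff.1 hso _ hxs
  let f : ContDiffBump (∑ k, w k • X k) := ⟨ε / 4, ε / 2, by linarith, by linarith⟩
  have hzero : spline X (bumpTest f) = 0 := hs _ ((f.tsupport_eq).trans_subset
    ((Metric.closedBall_subset_ball (by change ε / 2 < ε; linarith)).trans hεs))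
  obtain ⟨l, hl⟩ := id hX
  have hint := integrableOn_comp_sum_smul hl f.continuous f.hasCompactSupport
  have hinterior : Set.Ici (0 : ι → ℝ) ∈ 𝓝 1 := pi_Ici_mem_nhds fun _ => one_pos
  have hclosure : closure (interior (Set.Ici (0 : ι → ℝ))) = closure (Set.Ici 0) :=
    (convex_Ici (𝕜 := ℝ) _).closure_interior_eq_closure_of_nonempty_interior
      ⟨1, mem_interior_iff_mem_nhds.2 hinterior⟩
  have hf := Measure.eqOn_of_ae_eq ((setIntegral_eq_zero_iff_of_nonneg_ae
    (.of_forall fun _ => f.nonneg) hint).1 ((spline_apply hX _).symm.trans hzero))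
    (f.continuous.comp (by fun_prop)).continuousOn continuousOn_const
    (subset_closure.trans hclosure.ge) hw
  exact one_ne_zero ((f.one_of_mem_closedBall (Metric.mem_closedBall_self f.rIn_pos.le)).symm.trans
    hf)

theorem contDiff_spline_translate (hX : Pointed X) (φ : Test r) :
    ContDiff ℝ (⊤ : ℕ∞) fun ξ => spline X (translate ξ φ) := by
  have h := φ.hasCompactSupport.contDiff_convolution_right (ContinuousLinearMap.mul ℝ ℝ)
    (locallyIntegrableOn_univ.1 (spline_locallyIntegrable hX.neg)) φ.contDiff
  convert h using 1
  ext ξ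
  have hcont : Continuous fun t => ContinuousLinearMap.mul ℝ ℝ 1 (φ (ξ - t)) :=
    continuous_const.mul (φ.continuous.comp (continuous_const.sub continuous_id))
  rw [spline_translate hX, convolution_def, splineMeasure,
    integral_map (measurable_comb (-X)).aemeasurable hcont.aestronglyMeasurable]
  simp [orthantIntegral]

theorem isConvolution_spline (h : Pointed (Sum.elim X Y)) :
    IsConvolution (spline X) (spline Y) (spline (Sum.elim X Y)) := by
  obtain ⟨l, hl⟩ := id h
  have hlX (k) : 0 < l (X k) := hl (Sum.inl k)
  have hlY (k) : 0 < l (Y k) := hl (Sum.inr k)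
  have hX : Pointed X := ⟨l, hlX⟩
  have hY : Pointed Y := ⟨l, hlY⟩
  obtain ⟨M, hM, hXM⟩ := exists_forall_mem_normCone hlX
  obtain ⟨M', hM', hYM⟩ := exists_forall_mem_normCone hlY
  refine isConvolution_of_dsupport_subset (dsupport_spline_subset hX hXM)
    (dsupport_spline_subset hY hYM) (fun K => isBounded_normCone_inter_sub hM hM')
    (contDiff_spline_translate hY) fun φ ψ hψ => ?_
  rw [spline_eq_orthantIntegral h,
    orthantIntegral_sumElim hlX hlY φ.continuous φ.hasCompactSupport, spline_apply hX]
  refine (setIntegral_congr_fun measurableSet_Ici fun w hw => ?_).symm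
  rw [hψ _ (sum_smul_mem_normCone hXM hw), spline_translate hY, zero_add]

end Splines

section SplineDifference

variable {r d : ℕ} {ι : Type*} [Fintype ι] {S : Submodule ℝ (Vec r)} {μ : Measure (Vec r)}
  {Y : ι → Vec r} {l : Vec r →ₗ[ℝ] ℝ} {p : MvPolynomial (Fin r) ℝ}

/-- The distribution `T_Y - (-1)^|Y| T_{-Y}`. For the list `Y = (P_i, -N_i)` this is `R_i^B` up to
the sign `(-1)^|N_i|`. -/
noncomputable def splineDifference (Y : ι → Vec r) : Distr r :=
  spline Y - (-1 : ℝ) ^ Fintype.card ι • spline (-Y)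

theorem splineDifference_apply (Y : ι → Vec r) (φ : Test r) :
    splineDifference Y φ = spline Y φ - (-1) ^ Fintype.card ι * spline (-Y) φ := rfl

theorem splineDifference_translate (hY : Pointed Y) (φ : Test r) (ξ : Vec r) :
    splineDifference Y (translate ξ φ) =
      orthantIntegral Y φ ξ - (-1) ^ Fintype.card ι * orthantIntegral (-Y) φ ξ := by
  rw [splineDifference_apply, spline_translate hY, spline_translate hY.neg]

theorem contDiff_splineDifference_translate (hY : Pointed Y) (φ : Test r) :
    ContDiff ℝ (⊤ : ℕ∞) fun ξ => splineDifference Y (translate ξ φ) :=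
  (contDiff_spline_translate hY φ).sub
    (contDiff_const.mul (contDiff_spline_translate hY.neg φ))

theorem dsupport_splineDifference_subset {M : ℝ} (hM : 0 < M) (hY : Pointed Y)
    (hYM : ∀ k, Y k ∈ normCone l M) :
    Distribution.dsupport (splineDifference Y) ⊆ normCone (fun x => |l x|) M := by
  have hYM' (k : ι) : (-Y) k ∈ normCone (-l) M := by simpa [normCone] using hYM k
  have hneg : normCone (-l) M ⊆ normCone (fun x => |l x|) M := by
    simpa only [LinearMap.neg_apply, abs_neg] using normCone_subset_normCone_abs (l := -l) hM
  refine dsupport_subset_of_forall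
    (isClosed_normCone l.continuous_of_finiteDimensional.abs M) fun φ hφ => ?_
  rw [splineDifference_apply,
    spline_eq_zero hY hYM fun x hx => hφ x (normCone_subset_normCone_abs hM hx),
    spline_eq_zero hY.neg hYM' fun x hx => hφ x (hneg hx), mul_zero, sub_zero]

theorem dsupport_distrOfDensity_subset {f : Vec r → ℝ} (hμ : IsHaarOn S μ)
    (hf : LocallyIntegrable f μ) : Distribution.dsupport (distrOfDensity μ f) ⊆ S :=
  dsupport_subset_of_forall S.closed_of_finiteDimensional fun φ hφ => by
    rw [distrOfDensity_apply hf]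
    exact integral_eq_zero_of_ae (hμ.ae_mem.mono fun x hx => by simp [hφ x hx])

theorem exists_isConvolution_splineDifference (hμ : IsHaarOn (S ⊓ LinearMap.ker l) μ)
    (hp : p.IsHomogeneous d) (hYS : ∀ k, Y k ∈ S) (hY : ∀ k, 0 < l (Y k)) (k₀ : ι) :
    ∃ q : MvPolynomial (Fin r) ℝ, q.IsHomogeneous (d + (Fintype.card ι - 1)) ∧
      IsConvDensity μ (fun x => MvPolynomial.eval x p) Y
        ((extendAlong μ (Y k₀)).restrict {x | 0 < l x}) (fun x => MvPolynomial.eval x q) ∧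
      IsConvolution (distrOfDensity μ fun x => MvPolynomial.eval x p) (splineDifference Y)
        (distrOfDensity (extendAlong μ (Y k₀)) fun x => MvPolynomial.eval x q) := by
  have := hμ.isFiniteMeasureOnCompacts
  have := (hμ.extendAlong (hYS k₀) (hY k₀).ne').isFiniteMeasureOnCompacts
  have hp' := (MvPolynomial.continuous_eval p).locallyIntegrable (μ := μ)
  obtain ⟨M, hM, hYM⟩ := exists_forall_mem_normCone hY
  obtain ⟨q, hq, hqY, hqR⟩ := exists_isConvDensity_integral_sub hμ hp hYS hY k₀
  refine ⟨q, hq, hqY, isConvolution_of_dsupport_subset (dsupport_distrOfDensity_subset hμ hp')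
    (dsupport_splineDifference_subset hM ⟨l, hY⟩ hYM)
    (fun K hK => (isBounded_ker_inter_sub l M hK).subset
      (Set.inter_subset_inter_left _ fun x hx => hx.2))
    (contDiff_splineDifference_translate ⟨l, hY⟩) fun φ ψ hψ => ?_⟩
  rw [distrOfDensity_apply (MvPolynomial.continuous_eval q).locallyIntegrable,
    distrOfDensity_apply hp']
  simp only [mul_comm (φ _), ← hqR φ φ.continuous φ.hasCompactSupport, mul_comm (ψ _)]
  refine integral_congr_ae (hμ.ae_mem.mono fun x hx => ?_)
  simp only [hψ x hx, splineDifference_translate ⟨l, hY⟩]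

end SplineDifference

/-! ### Flags and layers -/

section Flag

variable {r : ℕ} (B : Module.Basis (Fin r) ℝ (Vec r))

theorem mem_flag_iff {i : ℕ} {x : Vec r} :
    x ∈ flag B i ↔ ∀ ν : Fin r, i ≤ ν → B.coord ν x = 0 := by
  simp only [flag, B.mem_span_image, Set.subset_def, Finset.mem_coe, Finsupp.mem_support_iff,
    B.coord_apply, Set.mem_ofPred_eq, ← not_le, not_imp_not]

theorem flag_mono : Monotone (flag (r := r) B) := fun _ _ h =>
  Submodule.span_mono (Set.image_mono fun _ hν => lt_of_lt_of_le hν h)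

theorem flag_eq_inf_ker (i : Fin r) :
    flag B i = flag B (i + 1) ⊓ LinearMap.ker (B.coord i) := by
  ext x
  simp only [Submodule.mem_inf, mem_flag_iff, LinearMap.mem_ker, Nat.succ_le_iff]
  refine ⟨fun h => ⟨fun ν hν => h ν hν.le, h i le_rfl⟩, fun h ν hν => ?_⟩
  obtain hlt | heq := hν.lt_or_eq
  · exact h.1 ν hlt
  · exact Fin.ext heq ▸ h.2

theorem flag_zero : flag (r := r) B 0 = ⊥ := by simp [flag]

theorem flag_self : flag B r = ⊤ :=
  eq_top_iff.2 fun _ _ => (mem_flag_iff B).2 fun ν hν => absurd ν.2 hν.not_gt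

theorem basis_mem_flag_succ_and_notMem_flag (i : Fin r) :
    B i ∈ flag B (i + 1) ∧ B i ∉ flag B i := by
  refine ⟨Submodule.subset_span ⟨i, Nat.lt_succ_self _, rfl⟩, fun h => ?_⟩
  simpa using (mem_flag_iff B).1 h i le_rfl

theorem exists_mem_flag_succ_notMem_flag {x : Vec r} (hx : x ≠ 0) :
    ∃ i : Fin r, x ∈ flag B (i + 1) ∧ x ∉ flag B i := by
  classical
  have hex : ∃ n, x ∈ flag B n := ⟨r, flag_self B ▸ Submodule.mem_top⟩
  have hle : Nat.find hex ≤ r := Nat.find_min' hex (flag_self B ▸ Submodule.mem_top)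
  rcases hn : Nat.find hex with _ | n
  · exact absurd ((Submodule.mem_bot ℝ).1 (flag_zero B ▸ hn ▸ Nat.find_spec hex)) hx
  · exact ⟨⟨n, by lia⟩, hn ▸ Nat.find_spec hex, Nat.find_min hex (by lia)⟩

theorem eq_of_mem_flag_succ_of_notMem_flag {i j : Fin r} {x : Vec r} (hi : x ∈ flag B (i + 1))
    (hi' : x ∉ flag B i) (hj : x ∈ flag B (j + 1)) (hj' : x ∉ flag B j) : i = j := by
  refine le_antisymm (not_lt.1 fun h => hi' ?_) (not_lt.1 fun h => hj' ?_)
  · exact flag_mono B (Nat.succ_le_of_lt h) hj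
  · exact flag_mono B (Nat.succ_le_of_lt h) hi

theorem flag_hom_ext {i : ℕ} {f g : flag B i →ₗ[ℝ] flag B i}
    (h : ∀ (ν : Fin r) (hν : (ν : ℕ) < i),
      f ⟨B ν, Submodule.subset_span ⟨ν, hν, rfl⟩⟩ = g ⟨B ν, Submodule.subset_span ⟨ν, hν, rfl⟩⟩) :
    f = g := by
  have hle : flag B i ≤ (LinearMap.eqLocus f g).map (flag B i).subtype :=
    Submodule.span_le.2 fun _ ⟨ν, hν, hx⟩ => hx ▸ ⟨_, h ν hν, rfl⟩
  refine LinearMap.ext fun x => ?_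
  obtain ⟨y, hy, hyx⟩ := hle x.2
  rwa [← Subtype.ext hyx]

theorem isPositive_iff (i : Fin r) {u : Vec r} (hu : u ∈ flag B (i + 1)) :
    IsPositive B i u ↔ 0 < B.coord i u := by
  have hbi : B i ∈ flag B (i + 1) := (basis_mem_flag_succ_and_notMem_flag B i).1
  let g : flag B (i + 1) →ₗ[ℝ] flag B (i + 1) :=
    LinearMap.transvection ((B.coord i).domRestrict _) (⟨u, hu⟩ - ⟨B i, hbi⟩)
  have hdet : LinearMap.det g = B.coord i u := by
    rw [LinearMap.transvection.det]
    simp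
  have hg : ∀ ν ≤ i, ∀ x : flag B (i + 1), (x : Vec r) = B ν →
      (g x : Vec r) = Function.update B i u ν := by
    rintro ν - x hx
    rcases eq_or_ne ν i with rfl | hne
    · simp [g, LinearMap.transvection.apply, hx]
    · simp [g, LinearMap.transvection.apply, hx, hne]
  refine ⟨fun ⟨f, hf, hpos⟩ => ?_, fun h => ⟨g, hg, hdet ▸ h⟩⟩
  obtain rfl : f = g := flag_hom_ext B fun ν hν =>
    have hνi : ν ≤ i := Nat.lt_succ_iff.1 hν
    Subtype.ext ((hf ν hνi _ rfl).trans (hg ν hνi _ rfl).symm)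
  exact hdet ▸ hpos

end Flag

section Layer

variable {r N : ℕ} (B : Module.Basis (Fin r) ℝ (Vec r)) (Z : Fin N → Vec r)

theorem mem_posPart_iff {i : Fin r} {k : Fin N} :
    k ∈ posPart Z B i ↔ Z k ∈ flag B (i + 1) ∧ 0 < B.coord i (Z k) := by
  simp only [posPart, Finset.mem_filter, Finset.mem_univ, true_and]
  refine and_congr_right fun h => ?_
  rw [isPositive_iff B i h, and_iff_right_of_imp]
  exact fun hpos hmem => hpos.ne' (flag_eq_inf_ker B i ▸ hmem).2

theorem mem_negPart_iff {i : Fin r} {k : Fin N} :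
    k ∈ negPart Z B i ↔ Z k ∈ flag B (i + 1) ∧ B.coord i (Z k) < 0 := by
  simp only [negPart, Finset.mem_filter, Finset.mem_univ, true_and]
  refine and_congr_right fun h => ?_
  rw [isPositive_iff B i h, flag_eq_inf_ker B i, Submodule.mem_inf, and_iff_right h,
    LinearMap.mem_ker, not_lt, and_comm, lt_iff_le_and_ne]

open Classical in
theorem mem_posPart_union_negPart_iff {i : Fin r} {k : Fin N} :
    k ∈ posPart Z B i ∪ negPart Z B i ↔ Z k ∈ flag B (i + 1) ∧ Z k ∉ flag B i := by
  simp only [posPart, negPart, Finset.mem_union, Finset.mem_filter, Finset.mem_univ, true_and,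
    ← and_or_left, Classical.em, and_true]

theorem disjoint_posPart_negPart (i : Fin r) : Disjoint (posPart Z B i) (negPart Z B i) :=
  Finset.disjoint_left.2 fun _ h h' =>
    lt_asymm ((mem_posPart_iff B Z).1 h).2 ((mem_negPart_iff B Z).1 h').2

theorem sum_card_posPart_add_card_negPart (hZ : ∀ k, Z k ≠ 0) :
    ∑ i, ((posPart Z B i).card + (negPart Z B i).card) = N := by
  classical
  simp only [← Finset.card_union_of_disjoint (disjoint_posPart_negPart B Z _)]
  rw [← Finset.card_biUnion fun i _ j _ hij => Finset.disjoint_left.2 fun k hi hj => hij ?_]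
  · refine (congrArg Finset.card (Finset.eq_univ_iff_forall.2 fun k => ?_)).trans
      (Finset.card_fin N)
    obtain ⟨i, hi⟩ := exists_mem_flag_succ_notMem_flag B (hZ k)
    exact Finset.mem_biUnion.2 ⟨i, Finset.mem_univ i, (mem_posPart_union_negPart_iff B Z).2 hi⟩
  · rw [mem_posPart_union_negPart_iff] at hi hj
    exact eq_of_mem_flag_succ_of_notMem_flag B hi.1 hi.2 hj.1 hj.2

/-- The list `(P_i, -N_i)`. -/
noncomputable def layerList (i : Fin r) : posPart Z B i ⊕ negPart Z B i → Vec r :=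
  Sum.elim (sub Z (posPart Z B i)) (-sub Z (negPart Z B i))

theorem layerList_mem_flag (i : Fin r) (k) : layerList B Z i k ∈ flag B (i + 1) := by
  rcases k with k | k
  · exact ((mem_posPart_iff B Z).1 k.2).1
  · exact Submodule.neg_mem _ ((mem_negPart_iff B Z).1 k.2).1

theorem coord_layerList_pos (i : Fin r) (k) : 0 < B.coord i (layerList B Z i k) := by
  rcases k with k | k
  · exact ((mem_posPart_iff B Z).1 k.2).2
  · exact ((neg_pos.2 ((mem_negPart_iff B Z).1 k.2).2).trans_eq (map_neg _ _).symm)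

theorem layerList_mem_range_reorient (i : Fin r) (k) :
    layerList B Z i k ∈ Set.range (reorient Z B) := by
  classical
  rcases k with ⟨k, hk⟩ | ⟨k, hk⟩
  · refine ⟨k, if_neg ?_⟩
    rintro ⟨j, hkj⟩
    obtain ⟨hi, hi'⟩ := (mem_posPart_union_negPart_iff B Z).1 (Finset.mem_union_left _ hk)
    obtain ⟨hj, hj'⟩ := (mem_posPart_union_negPart_iff B Z).1 (Finset.mem_union_right _ hkj)
    obtain rfl := eq_of_mem_flag_succ_of_notMem_flag B hi hi' hj hj'
    exact Finset.disjoint_left.1 (disjoint_posPart_negPart B Z i) hk hkj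
  · exact ⟨k, if_pos ⟨i, hk⟩⟩

theorem pointed_layerList (i : Fin r) : Pointed (layerList B Z i) :=
  ⟨B.coord i, coord_layerList_pos B Z i⟩

theorem neg_layerList (i : Fin r) :
    -layerList B Z i = Sum.elim (-sub Z (posPart Z B i)) (sub Z (negPart Z B i)) := by
  ext1 k
  rcases k with k | k <;> simp [layerList]

/-- The sign `(-1)^|N_i|`. -/
noncomputable def layerSign (i : Fin r) : ℝ := (-1) ^ (negPart Z B i).card

theorem layerSign_ne_zero (i : Fin r) : layerSign B Z i ≠ 0 := pow_ne_zero _ (by norm_num)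

theorem isConvolution_plus (i : Fin r) :
    IsConvolution (spline (sub Z (posPart Z B i))) (spline (-sub Z (negPart Z B i)))
      (spline (layerList B Z i)) :=
  isConvolution_spline (pointed_layerList B Z i)

theorem isConvolution_minus (i : Fin r) :
    IsConvolution (spline (-sub Z (posPart Z B i))) (spline (sub Z (negPart Z B i)))
      (spline (-layerList B Z i)) := by
  have h := (pointed_layerList B Z i).neg
  rw [neg_layerList] at h ⊢
  exact isConvolution_spline h

theorem Tplus_eq (i : Fin r) : Tplus Z B i = layerSign B Z i • spline (layerList B Z i) := by
  rw [Tplus, (isConvolution_plus B Z i).conv_eq, layerSign]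

theorem Rfactor_eq (i : Fin r) :
    Rfactor Z B i = layerSign B Z i • splineDifference (layerList B Z i) := by
  rw [Rfactor, Tplus_eq, Tminus, (isConvolution_minus B Z i).conv_eq, splineDifference, smul_sub,
    smul_smul, Fintype.card_sum, Fintype.card_coe, Fintype.card_coe, pow_add, layerSign,
    mul_left_comm, ← pow_add, Even.neg_one_pow ⟨_, rfl⟩, mul_one]

end Layer

/-! ### Local pieces on narrow cones -/

section NarrowCone

variable {r : ℕ} (B : Module.Basis (Fin r) ℝ (Vec r))

/-- The vectors whose first `i` coordinates are positive and decrease at least by the factor `ε`.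
These cones play the role of the neighbourhoods of `τ_c` for large `c`. -/
def narrowCone (i : ℕ) (ε : ℝ) : Set (Vec r) :=
  {z | (∀ ν : Fin r, (ν : ℕ) < i → 0 < B.coord ν z) ∧
    ∀ ν ν' : Fin r, ν < ν' → (ν' : ℕ) < i → B.coord ν' z < ε * B.coord ν z}

theorem isOpen_narrowCone (i : ℕ) (ε : ℝ) : IsOpen (narrowCone B i ε) := by
  have hc (ν : Fin r) : Continuous (B.coord ν) := (B.coord ν).continuous_of_finiteDimensional
  simp only [narrowCone, Set.ofPred_and, Set.ofPred_forall]
  exact (isOpen_iInter_of_finite fun ν => isOpen_iInter_of_finite fun _ =>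
    isOpen_lt continuous_const (hc ν)).inter <|
      isOpen_iInter_of_finite fun ν => isOpen_iInter_of_finite fun ν' =>
        isOpen_iInter_of_finite fun _ => isOpen_iInter_of_finite fun _ =>
          isOpen_lt (hc ν') (continuous_const.mul (hc ν))

/-- `narrowCone B r ε` as a convex cone. -/
noncomputable def narrowConvexCone (ε : ℝ) : ConvexCone ℝ (Vec r) where
  carrier := narrowCone B r ε
  smul_mem' c hc z hz := by
    refine ⟨fun ν hν => ?_, fun ν ν' hlt hν' => ?_⟩
    · rw [map_smul]
      exact mul_pos hc (hz.1 ν hν)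
    · simp only [map_smul, smul_eq_mul, mul_left_comm ε]
      exact mul_lt_mul_of_pos_left (hz.2 ν ν' hlt hν') hc
  add_mem' z hz z' hz' := by
    refine ⟨fun ν hν => ?_, fun ν ν' hlt hν' => ?_⟩
    · rw [map_add]
      exact add_pos (hz.1 ν hν) (hz'.1 ν hν)
    · simp only [map_add, mul_add]
      exact add_lt_add (hz.2 ν ν' hlt hν') (hz'.2 ν ν' hlt hν')

theorem coord_tau (c : ℝ) (ν : Fin r) : B.coord ν (tau B c) = 1 / c ^ (ν : ℕ) := by
  simp [tau, Finsupp.single_apply]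

theorem exists_forall_tau_mem_narrowCone {ε : ℝ} (hε : 0 < ε) :
    ∃ c₀ : ℝ, 0 < c₀ ∧ ∀ c ≥ c₀, tau B c ∈ narrowCone B r ε := by
  refine ⟨1 + 1 / ε, by positivity, fun c hc => ?_⟩
  have hε' : 0 < 1 / ε := by positivity
  have hc₁ : 1 ≤ c := by linarith
  have hεc : 1 / c < ε := (one_div_lt (by linarith) hε).2 (by linarith)
  refine ⟨fun ν _ => ?_, fun ν ν' hlt _ => ?_⟩
  · rw [coord_tau]
    positivity
  · rw [coord_tau, coord_tau]
    calc 1 / c ^ (ν' : ℕ) ≤ 1 / c ^ ((ν : ℕ) + 1) := by gcongr; exact hlt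
      _ = 1 / c * (1 / c ^ (ν : ℕ)) := by rw [pow_succ']; field_simp
      _ < ε * (1 / c ^ (ν : ℕ)) := by gcongr

variable {B}

theorem mem_narrowCone_of_abs_coord_sub_le {i : Fin r} {ε ε' M : ℝ} {z u : Vec r} (hε : 0 < ε)
    (hε' : 0 < ε') (hM : 0 ≤ M) (hεM : ε' * (1 + M + ε * M) = ε) (hu : u ∈ narrowCone B (i + 1) ε')
    (hzu : ∀ ν, |B.coord ν (u - z)| ≤ M * B.coord i u) : z ∈ narrowCone B i ε := by
  have hδ : 0 < 1 - ε' * M := by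
    refine pos_of_mul_pos_right (a := ε) ?_ hε.le
    calc 0 < ε' * (1 + M) := by positivity
      _ = ε * (1 - ε' * M) := by linear_combination hεM
  have hclose (ν' ν : Fin r) (hν : ν < i) :
      |B.coord ν' u - B.coord ν' z| ≤ ε' * M * B.coord ν u := by
    calc |B.coord ν' u - B.coord ν' z| ≤ M * B.coord i u := map_sub (B.coord ν') u z ▸ hzu ν'
      _ ≤ M * (ε' * B.coord ν u) :=
        mul_le_mul_of_nonneg_left (hu.2 ν i hν (Nat.lt_succ_self _)).le hM
      _ = ε' * M * B.coord ν u := by ring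
  have hlow (ν : Fin r) (hν : ν < i) : (1 - ε' * M) * B.coord ν u ≤ B.coord ν z := by
    linarith [le_abs_self (B.coord ν u - B.coord ν z), hclose ν ν hν]
  refine ⟨fun ν hν => ?_, fun ν ν' hlt hν' => ?_⟩
  · exact (mul_pos hδ (hu.1 ν (Nat.lt_succ_of_lt hν))).trans_le (hlow ν hν)
  · have hν : ν < i := hlt.trans hν'
    calc B.coord ν' z ≤ B.coord ν' u + ε' * M * B.coord ν u := by
          linarith [neg_abs_le (B.coord ν' u - B.coord ν' z), hclose ν' ν hν]
      _ < ε' * B.coord ν u + ε' * M * B.coord ν u := by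
        gcongr
        exact hu.2 ν ν' hlt (Nat.lt_succ_of_lt hν')
      _ = ε * ((1 - ε' * M) * B.coord ν u) := by linear_combination B.coord ν u * hεM
      _ ≤ ε * B.coord ν z := mul_le_mul_of_nonneg_left (hlow ν hν) hε.le

variable {ι κ : Type*} [Fintype κ] {Y : κ → Vec r}

theorem exists_forall_mem_narrowCone_of_add {i : Fin r} (hY : ∀ k, 0 < B.coord i (Y k)) {ε : ℝ}
    (hε : 0 < ε) : ∃ ε' : ℝ, 0 < ε' ∧ ∀ z ∈ flag B i, ∀ w : κ → ℝ, 0 ≤ w →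
      z + ∑ k, w k • Y k ∈ narrowCone B (i + 1) ε' → z ∈ narrowCone B i ε := by
  obtain ⟨M, hM, hYM⟩ := exists_forall_mem_normCone hY
  let C : ℝ := ‖(B.equivFunL : Vec r →L[ℝ] Fin r → ℝ)‖
  have hC : 0 ≤ C := norm_nonneg _
  refine ⟨ε / (1 + C * M + ε * (C * M)), by positivity, fun z hz w hw hzw =>
    mem_narrowCone_of_abs_coord_sub_le hε (by positivity) (by positivity)
      (div_mul_cancel₀ _ (by positivity)) hzw fun ν => ?_⟩
  have hz₀ : B.coord i z = 0 := (mem_flag_iff B).1 hz i le_rfl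
  rw [add_sub_cancel_left, map_add, hz₀, zero_add, mul_assoc]
  calc |B.coord ν (∑ k, w k • Y k)| ≤ ‖B.equivFunL (∑ k, w k • Y k)‖ :=
        norm_le_pi_norm (B.equivFunL (∑ k, w k • Y k)) ν
    _ ≤ C * ‖∑ k, w k • Y k‖ := (B.equivFunL : Vec r →L[ℝ] Fin r → ℝ).le_opNorm _
    _ ≤ C * (M * B.coord i (∑ k, w k • Y k)) :=
      mul_le_mul_of_nonneg_left (sum_smul_mem_normCone hYM hw) hC

variable [Fintype ι] {X : ι → Vec r} {μ ν : Measure (Vec r)} {p q : Vec r → ℝ} {ε : ℝ}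

theorem orthantIntegral_sumElim_comm (X : ι → Vec r) (Y : κ → Vec r) :
    orthantIntegral (Sum.elim X Y) = orthantIntegral (Sum.elim Y X) := by
  rw [← orthantIntegral_comp_equiv (Equiv.sumComm ι κ) (Sum.elim Y X)]
  exact congrArg _ (Sum.elim_swap).symm

variable (B) in
/-- On the narrow cone in `S_i` of width `ε`, the spline `T_X` of a list `X` in `S_i` is the
density `p` with respect to the measure `μ`. The cone is contained in `cone(X)`. -/
structure IsNarrowPiece (i : ℕ) (ε : ℝ) (X : ι → Vec r) (μ : Measure (Vec r)) (p : Vec r → ℝ) :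
    Prop where
  pointed : Pointed X
  mem_flag : ∀ k, X k ∈ flag B i
  subset_listCone : ↑(flag B i) ∩ narrowCone B i ε ⊆ listCone X
  orthantIntegral_eq : ∀ φ : Vec r → ℝ, Continuous φ → HasCompactSupport φ →
    (∀ z ∈ flag B i, φ z ≠ 0 → z ∈ narrowCone B i ε) →
    orthantIntegral X φ 0 = ∫ z, p z * φ z ∂μ

theorem mem_listCone_sumElim {i : Fin r} {ε' : ℝ} (hYS : ∀ k, Y k ∈ flag B (i + 1))
    (hY : ∀ k, 0 < B.coord i (Y k)) (k₀ : κ)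
    (hε : ∀ z ∈ flag B i, ∀ w : κ → ℝ, 0 ≤ w →
      z + ∑ k, w k • Y k ∈ narrowCone B (i + 1) ε' → z ∈ narrowCone B i ε)
    (hX : ↑(flag B i) ∩ narrowCone B i ε ⊆ listCone X) :
    ↑(flag B (i + 1)) ∩ narrowCone B (i + 1) ε' ⊆ listCone (Sum.elim X Y) := by
  classical
  rintro z ⟨hz, hzε⟩
  let t : ℝ := B.coord i z / B.coord i (Y k₀)
  have ht : 0 ≤ t := div_nonneg (hzε.1 i (Nat.lt_succ_self _)).le (hY k₀).le
  have hsum : ∑ k, (Pi.single k₀ t : κ → ℝ) k • Y k = t • Y k₀ := by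
    simp [Pi.single_apply]
  have hw : 0 ≤ (Pi.single k₀ t : κ → ℝ) := Pi.single_nonneg.2 ht
  have hzt : z - t • Y k₀ ∈ flag B i := by
    rw [flag_eq_inf_ker]
    refine ⟨Submodule.sub_mem _ hz (Submodule.smul_mem _ _ (hYS k₀)), ?_⟩
    rw [SetLike.mem_coe, LinearMap.mem_ker, map_sub, map_smul, smul_eq_mul,
      div_mul_cancel₀ _ (hY k₀).ne', sub_self]
  obtain ⟨u, hu, hzu⟩ := hX ⟨hzt, hε _ hzt _ hw (by rwa [hsum, sub_add_cancel])⟩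
  refine ⟨Sum.elim u (Pi.single k₀ t), Sum.rec hu hw, ?_⟩
  simp only [Fintype.sum_sum_type, Sum.elim_inl, Sum.elim_inr, hsum, ← hzu, sub_add_cancel]

theorem IsNarrowPiece.orthantIntegral_sumElim_eq {i : Fin r} {ε' : ℝ}
    (h : IsNarrowPiece B i ε X μ p) (hμ : IsHaarOn (flag B i) μ) (hp : Continuous p)
    (hYS : ∀ k, Y k ∈ flag B (i + 1)) (hY : ∀ k, 0 < B.coord i (Y k))
    (hε : ∀ z ∈ flag B i, ∀ w : κ → ℝ, 0 ≤ w →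
      z + ∑ k, w k • Y k ∈ narrowCone B (i + 1) ε' → z ∈ narrowCone B i ε)
    {φ : Vec r → ℝ} (hφ : Continuous φ) (hφc : HasCompactSupport φ)
    (hφε : ∀ z ∈ flag B (i + 1), φ z ≠ 0 → z ∈ narrowCone B (i + 1) ε') :
    orthantIntegral (Sum.elim X Y) φ 0 = ∫ x, p x * orthantIntegral Y φ x ∂μ := by
  have := hμ.isFiniteMeasureOnCompacts
  have hcoord : ∀ z ∈ flag B i, B.coord i z = 0 := fun z hz => (mem_flag_iff B).1 hz i le_rfl
  obtain ⟨f, hf⟩ := h.pointed.sumElim (fun k => hcoord _ (h.mem_flag k)) hY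
  have hfX (k : ι) : 0 < f (X k) := hf (.inl k)
  have hfY (k : κ) : 0 < f (Y k) := hf (.inr k)
  have hinner (w : κ → ℝ) (hw : w ∈ Set.Ici 0) :
      orthantIntegral X φ (0 + ∑ k, w k • Y k) = ∫ z, p z * φ (z + ∑ k, w k • Y k) ∂μ := by
    rw [← orthantIntegral_comp_add_const]
    refine h.orthantIntegral_eq _ (by fun_prop) (hφc.comp_homeomorph (Homeomorph.addRight _))
      fun z hz hne => hε z hz w hw (hφε _ (Submodule.add_mem _ (flag_mono B (Nat.le_succ _) hz)
        (Submodule.sum_mem _ fun k _ => Submodule.smul_mem _ _ (hYS k))) hne)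
  calc orthantIntegral (Sum.elim X Y) φ 0 = orthantIntegral Y (orthantIntegral X φ) 0 := by
        rw [orthantIntegral_sumElim_comm, orthantIntegral_sumElim hfY hfX hφ hφc]
    _ = ∫ w in Set.Ici (0 : κ → ℝ), ∫ z, p z * φ (z + ∑ k, w k • Y k) ∂μ :=
      setIntegral_congr_fun measurableSet_Ici hinner
    _ = ∫ x, p x * orthantIntegral Y φ x ∂μ :=
      (integral_mul_orthantIntegral (hμ.ae_mem.mono fun z hz => (hcoord z hz).ge) hY hp hφ
        hφc).symm

theorem IsNarrowPiece.exists_succ {i : Fin r} (h : IsNarrowPiece B i ε X μ p) (hε : 0 < ε)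
    (hμ : IsHaarOn (flag B i) μ) (hp : Continuous p) (hYS : ∀ k, Y k ∈ flag B (i + 1))
    (hY : ∀ k, 0 < B.coord i (Y k)) (k₀ : κ) (hν : ∀ᵐ x ∂ν, x ∈ flag B (i + 1))
    (hpq : IsConvDensity μ p Y (ν.restrict {x | 0 < B.coord i x}) q) :
    ∃ ε' : ℝ, 0 < ε' ∧ IsNarrowPiece B (i + 1) ε' (Sum.elim X Y) ν q := by
  obtain ⟨ε', hε', hcone⟩ := exists_forall_mem_narrowCone_of_add hY hε
  refine ⟨ε', hε', h.pointed.sumElim (fun k => (mem_flag_iff B).1 (h.mem_flag k) i le_rfl) hY,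
    Sum.rec (fun k => flag_mono B (Nat.le_succ _) (h.mem_flag k)) hYS,
    mem_listCone_sumElim hYS hY k₀ hcone h.subset_listCone, fun φ hφ hφc hφε => ?_⟩
  rw [h.orthantIntegral_sumElim_eq hμ hp hYS hY hcone hφ hφc hφε, hpq φ hφ hφc]
  refine setIntegral_eq_integral_of_ae_compl_eq_zero (hν.mono fun z hz hneg => ?_)
  by_contra hne
  exact hneg ((hφε z hz (right_ne_zero_of_mul hne)).1 i (Nat.lt_succ_self _))

end NarrowCone

/-! ### Induction along the flag -/

section PartialPiece

variable {r N : ℕ} (B : Module.Basis (Fin r) ℝ (Vec r)) (Z : Fin N → Vec r)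

/-- The first `i` steps of the construction: `R_1^B * ⋯ * R_i^B` is `s • p` on `S_i` and
`T_1^{B+} * ⋯ * T_i^{B+}` is `s • T_X`, where `p` is the piece of `T_X` on a narrow cone. -/
structure IsPartialPiece (i : ℕ) (hi : i ≤ r) {ι : Type} [Fintype ι] (X : ι → Vec r) (s ε : ℝ)
    (μ : Measure (Vec r)) (p : MvPolynomial (Fin r) ℝ) (d : ℕ) : Prop where
  isHaarOn : IsHaarOn (flag B i) μ
  isHomogeneous : p.IsHomogeneous d
  degree_add : d + i = ∑ ν : Fin i,
    ((posPart Z B (ν.castLE hi)).card + (negPart Z B (ν.castLE hi)).card)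
  ne_zero : s ≠ 0
  pos : 0 < ε
  isNarrowPiece : IsNarrowPiece B i ε X μ fun x => MvPolynomial.eval x p
  mem_range : ∀ k, X k ∈ Set.range (reorient Z B)
  iterConvolvable_R : IterConvolvable i fun ν => Rfactor Z B (ν.castLE hi)
  iterConv_R : iterConv i (fun ν => Rfactor Z B (ν.castLE hi)) =
    s • distrOfDensity μ fun x => MvPolynomial.eval x p
  iterConvolvable_T : IterConvolvable i fun ν => Tplus Z B (ν.castLE hi)
  iterConv_T : iterConv i (fun ν => Tplus Z B (ν.castLE hi)) = s • spline X

theorem isPartialPiece_zero :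
    IsPartialPiece B Z 0 (Nat.zero_le r) Empty.elim 1 1 (Measure.dirac 0) 1 0 where
  isHaarOn := flag_zero B ▸ isHaarOn_bot
  isHomogeneous := MvPolynomial.isHomogeneous_one _ _
  degree_add := by simp
  ne_zero := one_ne_zero
  pos := one_pos
  isNarrowPiece :=
    { pointed := ⟨0, Empty.rec⟩
      mem_flag := Empty.rec
      subset_listCone := fun z hz =>
        ⟨0, fun _ => le_rfl, by simpa [flag_zero] using hz.1⟩
      orthantIntegral_eq := fun φ _ _ _ => by simp [orthantIntegral_of_isEmpty] }
  mem_range := Empty.rec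
  iterConvolvable_R := trivial
  iterConv_R := by
    ext φ
    rw [one_smul, distrOfDensity_apply (by simpa using locallyIntegrable_const 1)]
    simp [iterConv]
  iterConvolvable_T := trivial
  iterConv_T := by
    ext φ
    rw [one_smul, spline_eq_orthantIntegral ⟨0, Empty.rec⟩, orthantIntegral_of_isEmpty]
    rfl

variable {B Z}

theorem IsPartialPiece.exists_succ {i : ℕ} (hi : i + 1 ≤ r) {ι : Type} [Fintype ι]
    {X : ι → Vec r} {s ε : ℝ} {μ : Measure (Vec r)} {p : MvPolynomial (Fin r) ℝ} {d : ℕ}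
    (h : IsPartialPiece B Z i (Nat.le_of_succ_le hi) X s ε μ p d)
    (k₀ : posPart Z B ⟨i, hi⟩ ⊕ negPart Z B ⟨i, hi⟩) :
    ∃ s' ε' μ' p' d',
      IsPartialPiece B Z (i + 1) hi (Sum.elim X (layerList B Z ⟨i, hi⟩)) s' ε' μ' p' d' := by
  let j : Fin r := ⟨i, hi⟩
  have hY := coord_layerList_pos B Z j
  have hYS := layerList_mem_flag B Z j
  have hμ : IsHaarOn (flag B (j + 1) ⊓ LinearMap.ker (B.coord j)) μ :=
    flag_eq_inf_ker B j ▸ h.isHaarOn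
  have hν := hμ.extendAlong (hYS k₀) (hY k₀).ne'
  obtain ⟨q, hq, hqY, hqR⟩ :=
    exists_isConvolution_splineDifference hμ h.isHomogeneous hYS hY k₀
  obtain ⟨ε', hε', hnarrow⟩ := IsNarrowPiece.exists_succ (i := j) h.isNarrowPiece h.pos h.isHaarOn
    (MvPolynomial.continuous_eval p) hYS hY k₀ hν.ae_mem hqY
  have hsign := layerSign_ne_zero B Z j
  have hR := hqR.smul h.ne_zero hsign
  rw [← h.iterConv_R, ← Rfactor_eq] at hR
  have hT := (isConvolution_spline hnarrow.pointed).smul h.ne_zero hsign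
  rw [← h.iterConv_T, ← Tplus_eq] at hT
  have hcard : Fintype.card (posPart Z B j ⊕ negPart Z B j) =
      (posPart Z B j).card + (negPart Z B j).card := by
    simp only [Fintype.card_sum, Fintype.card_coe]
  have hcard_pos : 0 < Fintype.card (posPart Z B j ⊕ negPart Z B j) := Fintype.card_pos_iff.2 ⟨k₀⟩
  refine ⟨s * layerSign B Z j, ε', _, q, _, hν, hq, ?_, mul_ne_zero h.ne_zero hsign, hε', hnarrow,
    Sum.rec h.mem_range (layerList_mem_range_reorient B Z j), ⟨h.iterConvolvable_R, _, hR⟩,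
    hR.conv_eq, ⟨h.iterConvolvable_T, _, hT⟩, hT.conv_eq⟩
  rw [Fin.sum_univ_castSucc]
  calc d + (Fintype.card (posPart Z B j ⊕ negPart Z B j) - 1) + (i + 1)
      = (d + i) + ((posPart Z B j).card + (negPart Z B j).card) := by
        rw [hcard] at hcard_pos ⊢
        omega
    _ = _ := congrArg (· + _) h.degree_add

variable (B)

theorem exists_isPartialPiece (hZ : ∀ i : Fin r, ∃ k, Z k ∈ flag B (i + 1) ∧ Z k ∉ flag B i)
    (i : ℕ) (hi : i ≤ r) : ∃ (ι : Type) (_ : Fintype ι) (X : ι → Vec r) (s ε : ℝ)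
      (μ : Measure (Vec r)) (p : MvPolynomial (Fin r) ℝ) (d : ℕ),
      IsPartialPiece B Z i hi X s ε μ p d := by
  classical
  induction i with
  | zero => exact ⟨_, _, _, _, _, _, _, _, isPartialPiece_zero B Z⟩
  | succ i ih =>
    obtain ⟨_, _, _, _, _, _, _, _, h⟩ := ih (Nat.le_of_succ_le hi)
    obtain ⟨k, hk⟩ := hZ ⟨i, hi⟩
    have k₀ : posPart Z B ⟨i, hi⟩ ⊕ negPart Z B ⟨i, hi⟩ :=
      (Finset.mem_union.1 ((mem_posPart_union_negPart_iff B Z).2 hk)).by_cases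
        (fun h => .inl ⟨k, h⟩) fun h => .inr ⟨k, h⟩
    exact ⟨_, _, _, h.exists_succ hi k₀⟩

end PartialPiece

section Conclusion

variable {r N : ℕ} {B : Module.Basis (Fin r) ℝ (Vec r)} {Z : Fin N → Vec r}

theorem listCone_subset_listCone {ι κ : Type*} [Fintype ι] [Fintype κ] {X : ι → Vec r}
    {Y : κ → Vec r} (h : ∀ k, X k ∈ Set.range Y) : listCone X ⊆ listCone Y := by
  classical
  choose σ hσ using h
  rintro _ ⟨w, hw, rfl⟩
  refine ⟨fun j => ∑ k with σ k = j, w k, fun j => Finset.sum_nonneg fun k _ => hw k, ?_⟩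
  rw [← Finset.sum_fiberwise _ σ]
  refine Finset.sum_congr rfl fun j _ => ?_
  rw [Finset.sum_smul]
  exact Finset.sum_congr rfl fun k hk => by rw [← hσ, (Finset.mem_filter.1 hk).2]

theorem IsHaarOn.exists_distrOfDensity_eq_polyDistr {μ : Measure (Vec r)}
    (hμ : IsHaarOn (⊤ : Submodule ℝ (Vec r)) μ) (p : MvPolynomial (Fin r) ℝ) :
    ∃ a : ℝ, distrOfDensity μ (fun x => MvPolynomial.eval x p) =
      polyDistr (MvPolynomial.C a * p) := by
  have := hμ.isAddLeftInvariant
  have := hμ.isFiniteMeasureOnCompacts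
  refine ⟨(Measure.addHaarScalarFactor μ volume : NNReal), DFunLike.ext _ _ fun φ => ?_⟩
  rw [distrOfDensity_apply (MvPolynomial.continuous_eval p).locallyIntegrable, polyDistr_apply]
  conv_lhs => rw [Measure.isAddLeftInvariant_eq_smul μ volume, integral_smul_nnreal_measure,
    NNReal.smul_def, smul_eq_mul, ← integral_const_mul]
  simp only [map_mul, MvPolynomial.eval_C, mul_left_comm]

theorem polyDistr_C_mul (s : ℝ) (p : MvPolynomial (Fin r) ℝ) :
    polyDistr (MvPolynomial.C s * p) = s • polyDistr p := by
  ext φ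
  change _ = s * polyDistr p φ
  simp only [polyDistr_apply, map_mul, MvPolynomial.eval_C, mul_left_comm _ s, integral_const_mul]

theorem wellDefined (hR : IterConvolvable r (Rfactor Z B)) (hT : IterConvolvable r (Tplus Z B)) :
    WellDefined Z B := by
  have hpos (i : Fin r) : Pointed (sub Z (posPart Z B i)) :=
    ⟨B.coord i, fun k => coord_layerList_pos B Z i (.inl k)⟩
  have hneg (i : Fin r) : Pointed (-sub Z (negPart Z B i)) :=
    ⟨B.coord i, fun k => coord_layerList_pos B Z i (.inr k)⟩
  exact ⟨hpos, fun i => (hpos i).neg, fun i => by simpa using (hneg i).neg, hneg,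
    fun i => ⟨_, isConvolution_plus B Z i⟩, fun i => ⟨_, isConvolution_minus B Z i⟩, hR, hT⟩

variable {ι : Type} [Fintype ι] {X : ι → Vec r} {s ε : ℝ} {μ : Measure (Vec r)}
  {p q : MvPolynomial (Fin r) ℝ} {d : ℕ}

namespace IsPartialPiece

theorem exists_RB_eq_polyDistr (h : IsPartialPiece B Z r le_rfl X s ε μ p d) :
    ∃ a : ℝ, RB Z B = polyDistr (MvPolynomial.C a * p) := by
  obtain ⟨a, ha⟩ :=
    IsHaarOn.exists_distrOfDensity_eq_polyDistr (flag_self B ▸ h.isHaarOn) p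
  refine ⟨s * a, h.iterConv_R.trans ?_⟩
  rw [ha, map_mul, mul_assoc, polyDistr_C_mul s]

theorem TB_apply_eq_RB_apply (h : IsPartialPiece B Z r le_rfl X s ε μ p d) {φ : Test r}
    (hφ : tsupport φ ⊆ narrowCone B r ε) : TB Z B φ = RB Z B φ := by
  have := h.isHaarOn.isFiniteMeasureOnCompacts
  have hspline : spline X φ = distrOfDensity μ (fun x => MvPolynomial.eval x p) φ := by
    rw [spline_eq_orthantIntegral h.isNarrowPiece.pointed,
      distrOfDensity_apply (MvPolynomial.continuous_eval p).locallyIntegrable,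
      h.isNarrowPiece.orthantIntegral_eq φ φ.continuous φ.hasCompactSupport
        fun z _ hz => hφ (subset_tsupport _ hz)]
    simp only [mul_comm]
  calc TB Z B φ = (s • spline X) φ := DFunLike.congr_fun h.iterConv_T φ
    _ = s * distrOfDensity μ (fun x => MvPolynomial.eval x p) φ := congrArg (s * ·) hspline
    _ = RB Z B φ := (DFunLike.congr_fun h.iterConv_R φ).symm

theorem narrowCone_subset_listCone (h : IsPartialPiece B Z r le_rfl X s ε μ p d) :
    narrowCone B r ε ⊆ listCone X := fun _ hz =>
  h.isNarrowPiece.subset_listCone ⟨flag_self B ▸ Submodule.mem_top, hz⟩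

theorem RB_ne_zero (h : IsPartialPiece B Z r le_rfl X s ε μ p d) : RB Z B ≠ 0 := by
  intro hR
  obtain ⟨c, -, hc⟩ := exists_forall_tau_mem_narrowCone B h.pos
  have hmem : tau B c ∈ Distribution.dsupport (TB Z B) := by
    have hT : TB Z B = s • spline X := h.iterConv_T
    rw [hT, dsupport_smul h.ne_zero]
    exact listCone_subset_dsupport_spline h.isNarrowPiece.pointed
      (h.narrowCone_subset_listCone (hc c le_rfl))
  refine (Distribution.notMem_dsupport_iff _).2
    ⟨narrowCone B r ε, fun φ hφ => ?_, isOpen_narrowCone B r ε, hc c le_rfl⟩ hmem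
  rw [h.TB_apply_eq_RB_apply hφ, hR]
  rfl

theorem isLocalPieceNearTau (h : IsPartialPiece B Z r le_rfl X s ε μ p d)
    (hq : RB Z B = polyDistr q) : IsLocalPieceNearTau Z B q :=
  ⟨narrowConvexCone B ε, isOpen_narrowCone B r ε,
    h.narrowCone_subset_listCone.trans (listCone_subset_listCone h.mem_range),
    exists_forall_tau_mem_narrowCone B h.pos, fun _ hφ => hq ▸ h.TB_apply_eq_RB_apply hφ⟩

theorem degree_eq (h : IsPartialPiece B Z r le_rfl X s ε μ p d) (hZ : ∀ k, Z k ≠ 0) :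
    d = N - r :=
  Nat.eq_sub_of_add_eq (h.degree_add.trans (sum_card_posPart_add_card_negPart B Z hZ))

end IsPartialPiece

end Conclusion

end ZonotopalSpline

open ZonotopalSpline in
theorem proposition3p1_general {r N : ℕ} (Z : Fin N → Vec r)
    (B : Module.Basis (Fin r) ℝ (Vec r))
    (hZ : ∀ i : Fin r, ∃ k, Z k ∈ flag B (i + 1) ∧ Z k ∉ flag B i) :
    WellDefined Z B ∧
    ∃ p : MvPolynomial (Fin r) ℝ,
      RB Z B = polyDistr p ∧
      p ≠ 0 ∧
      IsLocalPieceNearTau Z B p ∧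
      ((∀ k, Z k ≠ 0) → p.IsHomogeneous (N - r)) := by
  obtain ⟨ι, _, X, s, ε, μ, p, d, h⟩ := exists_isPartialPiece B hZ r le_rfl
  obtain ⟨a, ha⟩ := h.exists_RB_eq_polyDistr
  refine ⟨wellDefined h.iterConvolvable_R h.iterConvolvable_T, MvPolynomial.C a * p, ha, ?_,
    h.isLocalPieceNearTau ha, fun hZ₀ => ?_⟩
  · intro hp
    refine h.RB_ne_zero ?_
    rw [ha, hp, ← zero_mul (1 : MvPolynomial (Fin r) ℝ), ← map_zero MvPolynomial.C, polyDistr_C_mul,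
      zero_smul]
  · rw [← h.degree_eq hZ₀]
    exact h.isHomogeneous.C_mul a

theorem proposition3p1 {r N : ℕ} (Z : Fin N → ZonotopalSpline.Vec r)
    (e : Fin r → Fin N) (he : StrictMono e) (hb : LinearIndependent ℝ (Z ∘ e)) :
    ZonotopalSpline.WellDefined Z (Z ∘ e) ∧
    ∃ p : MvPolynomial (Fin r) ℝ,
      ZonotopalSpline.RB Z (Z ∘ e) = ZonotopalSpline.polyDistr p ∧
      p ≠ 0 ∧
      ZonotopalSpline.IsLocalPieceNearTau Z (Z ∘ e) p ∧
      ((∀ k, Z k ≠ 0) → p.IsHomogeneous (N - r)) := by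
  obtain ⟨B, hB⟩ : ∃ B : Module.Basis (Fin r) ℝ (ZonotopalSpline.Vec r), ⇑B = Z ∘ e :=
    ⟨basisOfLinearIndependentOfCardEqFinrank' _ hb (by simp), by simp⟩
  have hBe (i : Fin r) : B i = Z (e i) := congrFun hB i
  exact hB ▸ proposition3p1_general Z B fun i =>
    ⟨e i, hBe i ▸ ZonotopalSpline.basis_mem_flag_succ_and_notMem_flag B i⟩
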